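/- Let $n\ge 2$ and let $\theta=(\theta_{ij})\in[0,1]^{n\times n}$ be a symmetric matrix with zero diagonal. One observes the adjacency matrix $A\in\{0,1\}^{n\times n}$ of a random undirected graph on $[n]=\{1,\dots,n\}$: the entries $A_{ij}$, $1\le j<i\le n$, are independent, $A_{ij}\sim\mathrm{Bernoulli}(\theta_{ij})$, $A_{ji}=A_{ij}$ and $A_{ii}=0$. Write $\mathbb{E}_\theta$ for the expectation under this law and $\|\cdot\|_{\mathrm{op}}$ for the largest singular value. For $\beta>0$ and an integer $k\ge 1$ let $$\Theta(\beta)=\Bigl\{\theta=\theta^T\in[0,1]^{n\times n}:\ \theta_{ii}=0 \text{ for all } i,\ \max_{i,j}\theta_{ij}\le\beta\Bigr\},$$ and let $\Theta_k$ be the set of $\theta\in[0,1]^{n\times n}$ with $\theta_{ii}=0$ for all $i$ for which there are a map $z:[n]\to[k]$ and a symmetric matrix $Q\in[0,1]^{k\times k}$ with $\theta_{ij}=Q_{z(i)z(j)}$ for all $i\ne j$. Estimators $\hat\theta=\hat\theta(A)$ are arbitrary functions of $A$ with values in $\mathbb{R}^{n\times n}$. For $t>0$ let $A^{(t)}$ be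 the trimmed adjacency matrix, obtained from $A$ by replacing by zeros all rows and columns $i$ whose degree $\sum_l A_{il}$ exceeds $t$. **Theorem.** There are universal constants $C,\tau>0$ such that for all integers $n\ge2$, $k\ge2$ and all real $\beta$ with $n^{-1}\le\beta\le1$, $$C^{-1}\beta n\ \le\ \inf_{\hat\theta}\sup_{\theta\in\Theta(\beta)\cap\Theta_k}\mathbb{E}_\theta\|\hat\theta-\theta\|_{\mathrm{op}}^2\ \le\ C\beta n \quad\text{and}\quad C^{-1}\beta n\ \le\ \inf_{\hat\theta}\sup_{\theta\in\Theta(\beta)}\mathbb{E}_\theta\|\hat\theta-\theta\|_{\mathrm{op}}^2\ \le\ C\beta n .$$ Moreover, the upper bound is attained by the adjacency matrix if $\beta\ge n^{-1}\log n$ and by the trimmed adjacency matrix otherwise: $$\sup_{\theta\in\Theta(\beta)}\mathbb{E}_\theta\|A-\theta\|_{\mathrm{op}}^2\le C\beta n\quad\text{if }\beta\ge\frac{\log n}{n},\qquad \sup_{\theta\in\Theta(\beta)}\mathbb{E}_\theta\|A^{(\tau\beta n)}-\theta\|_{\mathrm{op}}^2\le C\beta n\quad\text{if }\beta<\frac{\log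 n}{n}.$$ -/

import Mathlib

open MeasureTheory ProbabilityTheory
open scoped ENNReal

namespace NetworkRisk

/-- The largest singular value of a real square matrix: the norm of the linear map it induces on
Euclidean space. -/
noncomputable def opNorm {n : ℕ} (M : Matrix (Fin n) (Fin n) ℝ) : ℝ :=
  ‖Matrix.toEuclideanCLM (n := Fin n) (𝕜 := ℝ) M‖

/-- The unordered pairs of distinct nodes, written as `(i, j)` with `j < i`. -/
abbrev NodePair (n : ℕ) : Type := {p : Fin n × Fin n // p.2 < p.1}

/-- The law of the edge indicators `A i j`, `j < i`: independent, the indicator of the pair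
`(i, j)` being Bernoulli with mean `θ i j`. (The truncation of `θ i j` to `[0, 1]` only serves to
make the definition total: it does nothing for matrices with entries in `[0, 1]`.) -/
noncomputable def edgeLaw {n : ℕ} (θ : Matrix (Fin n) (Fin n) ℝ) : Measure (NodePair n → Bool) :=
  Measure.pi fun p =>
    bernoulliMeasure true false (Set.projIcc (0 : ℝ) 1 zero_le_one (θ p.1.1 p.1.2))

/-- The symmetric adjacency matrix, with zero diagonal, of the graph with edge indicators `ω`. -/
def adjacency {n : ℕ} (ω : NodePair n → Bool) : Matrix (Fin n) (Fin n) ℝ :=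
  Matrix.of fun i j =>
    if h : j < i then (if ω ⟨(i, j), h⟩ then 1 else 0)
    else if h : i < j then (if ω ⟨(j, i), h⟩ then 1 else 0)
    else 0

/-- An estimator: a map from the observed adjacency matrix to real matrices. As the adjacency
matrix takes finitely many values, no measurability requirement is needed. -/
abbrev Estimator (n : ℕ) : Type := Matrix (Fin n) (Fin n) ℝ → Matrix (Fin n) (Fin n) ℝ

/-- The expected squared operator norm of the error of an estimator at `θ`. -/
noncomputable def risk {n : ℕ} (est : Estimator n) (θ : Matrix (Fin n) (Fin n) ℝ) : ℝ≥0∞ :=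
  ∫⁻ ω, ENNReal.ofReal (opNorm (est (adjacency ω) - θ) ^ 2) ∂(edgeLaw θ)

/-- The largest risk of an estimator over a parameter space. -/
noncomputable def worstRisk {n : ℕ} (est : Estimator n)
    (Θ : Set (Matrix (Fin n) (Fin n) ℝ)) : ℝ≥0∞ :=
  ⨆ θ ∈ Θ, risk est θ

/-- The minimax risk over a parameter space. -/
noncomputable def minimaxRisk {n : ℕ} (Θ : Set (Matrix (Fin n) (Fin n) ℝ)) : ℝ≥0∞ :=
  ⨅ est : Estimator n, worstRisk est Θ

/-- The sparse parameter space `Θ(β)`. -/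
def sparseSpace (n : ℕ) (β : ℝ) : Set (Matrix (Fin n) (Fin n) ℝ) :=
  {θ | θ.IsSymm ∧ (∀ i j, θ i j ∈ Set.Icc (0 : ℝ) 1) ∧ (∀ i, θ i i = 0) ∧ ∀ i j, θ i j ≤ β}

/-- The stochastic block model `Θ_k` with (at most) `k` clusters; the diagonal is set to zero. -/
def blockSpace (n k : ℕ) : Set (Matrix (Fin n) (Fin n) ℝ) :=
  {θ | (∀ i j, θ i j ∈ Set.Icc (0 : ℝ) 1) ∧ (∀ i, θ i i = 0) ∧
    ∃ (z : Fin n → Fin k) (Q : Matrix (Fin k) (Fin k) ℝ),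
      (∀ a b, Q a b ∈ Set.Icc (0 : ℝ) 1) ∧ (∀ a b, Q a b = Q b a) ∧
      ∀ i j, i ≠ j → θ i j = Q (z i) (z j)}

/-- The estimator that returns the adjacency matrix itself. -/
def adjacencyEstimator (n : ℕ) : Estimator n := fun A => A

/-- The trimmed adjacency matrix at level `t`: the rows and the columns of the nodes whose degree
exceeds `t` are replaced by zeros. -/
noncomputable def trimmedEstimator (n : ℕ) (t : ℝ) : Estimator n := fun A =>
  Matrix.of fun i j => if t < ∑ l, A i l ∨ t < ∑ l, A j l then 0 else A i j

end NetworkRisk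

/-! Lower bound. This is an Assouad argument on two-block models. The nodes of the first half, S,
are fixed in one block, each other node may lie in either block, and the edge probabilities are β/4
or β/4 + δ with δ² = β/(16n). Moving one node affects at most n edge laws, each at chi-square cost
at most 1/(2n), so its position cannot be recovered reliably (`likelihood_flip_le`,
`bernMean_two_point`), and the sum of its row over S is estimated with an error of order nδ. Testing
the error matrix on the indicator of S collects these errors over all nodes outside S into a squared
operator norm of order n²δ², that is βn (`sum_risk_twoBlock_ge`).

Upper bound. This is the Friedman–Kahn–Szemerédi and Feige–Ofek method. The operator norm is read
off from integer vectors of squared length at most 9n (`opNorm_le_of_grid`), and the products c_i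
f_j are split at the threshold 2^m, which is of order √(βn). The light products are bounded enough
for Bernstein's inequality to survive a union bound over the exponentially many grid vectors
(`prob_light_le`). The heavy products contribute little against θ deterministically
(`sum_heavy_mean_le`). Against A they are grouped by dyadic levels of c and f. Very unequal levels
are controlled by bounded degrees, comparable levels by a discrepancy property of edge counts that
holds with high probability (`prob_discrepancy_le`, `sum_heavy_levels_le`).

Trimming supplies the bounded degrees. It costs only a bias, which is small because degree tails
decay exponentially in βn (`bernMean_trimmingBias_le`). When βn ≥ log n, with high probability no
node is trimmed, so A itself has the same rate (`bernMean_adjacency_le`). -/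

namespace NetworkRisk

/-! ### Products of Bernoulli laws as finite weighted sums: exponential moments, union bounds,
two-point testing. -/

section BernoulliProduct

variable {P : Type*} [Fintype P]

/-- The probability of the outcome `ω` of independent Bernoulli variables with means `q`. -/
def bernWeight (q : P → ℝ) (ω : P → Bool) : ℝ := ∏ p, if ω p then q p else 1 - q p

/-- The expectation of `f` under independent Bernoulli variables with means `q`. -/
def bernMean [DecidableEq P] (q : P → ℝ) (f : (P → Bool) → ℝ) : ℝ :=
  ∑ ω, bernWeight q ω * f ω

lemma bernWeight_nonneg {q : P → ℝ} (hq : ∀ p, q p ∈ Set.Icc (0 : ℝ) 1) (ω : P → Bool) :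
    0 ≤ bernWeight q ω := by
  refine Finset.prod_nonneg fun p _ => ?_
  have := hq p
  split_ifs
  · exact this.1
  · linarith [this.2]

lemma bernWeight_pos {q : P → ℝ} (hq : ∀ p, q p ∈ Set.Ioo (0 : ℝ) 1) (ω : P → Bool) :
    0 < bernWeight q ω := by
  refine Finset.prod_pos fun p _ => ?_
  have := hq p
  split_ifs
  · exact this.1
  · linarith [this.2]

variable [DecidableEq P]

/-- Independence in algebraic form: total mass, moment generating function and chi-square moment all
factor over the coordinates through this identity. -/
lemma sum_prod_bool (g : P → Bool → ℝ) :
    ∑ ω : P → Bool, ∏ p, g p (ω p) = ∏ p, (g p true + g p false) := by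
  have h := Finset.prod_univ_sum (fun _ : P => (Finset.univ : Finset Bool)) g
  rw [Fintype.piFinset_univ] at h
  simpa using h.symm

lemma sum_bernWeight (q : P → ℝ) : ∑ ω, bernWeight q ω = 1 := by
  have := sum_prod_bool (fun p b => if b then q p else 1 - q p)
  simpa [bernWeight] using this

lemma bernMean_mono {q : P → ℝ} (hq : ∀ p, q p ∈ Set.Icc (0 : ℝ) 1) {f g : (P → Bool) → ℝ}
    (h : ∀ ω, f ω ≤ g ω) : bernMean q f ≤ bernMean q g :=
  Finset.sum_le_sum fun ω _ => mul_le_mul_of_nonneg_left (h ω) (bernWeight_nonneg hq ω)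

@[simp]
lemma bernMean_const (q : P → ℝ) (c : ℝ) : bernMean q (fun _ => c) = c := by
  simp [bernMean, ← Finset.sum_mul, sum_bernWeight]

lemma bernMean_add (q : P → ℝ) (f g : (P → Bool) → ℝ) :
    bernMean q (fun ω => f ω + g ω) = bernMean q f + bernMean q g := by
  simp [bernMean, mul_add, Finset.sum_add_distrib]

lemma bernMean_const_mul (q : P → ℝ) (c : ℝ) (f : (P → Bool) → ℝ) :
    bernMean q (fun ω => c * f ω) = c * bernMean q f := by
  simp only [bernMean, Finset.mul_sum]
  exact Finset.sum_congr rfl fun ω _ => by ring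

lemma bernMean_sum {ι : Type*} (q : P → ℝ) (s : Finset ι) (f : ι → (P → Bool) → ℝ) :
    bernMean q (fun ω => ∑ i ∈ s, f i ω) = ∑ i ∈ s, bernMean q (f i) := by
  simp only [bernMean, Finset.mul_sum]
  exact Finset.sum_comm

/-- The moment generating function of a weighted sum of independent Bernoulli variables. -/
lemma bernMean_exp_le {q : P → ℝ} (hq : ∀ p, q p ∈ Set.Icc (0 : ℝ) 1) (u : P → ℝ) :
    bernMean q (fun ω => Real.exp (∑ p, (if ω p then 1 else 0) * u p)) ≤
      Real.exp (∑ p, q p * (Real.exp (u p) - 1)) := by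
  have h := sum_prod_bool (fun p b => (if b then q p else 1 - q p) *
    Real.exp ((if b then 1 else 0) * u p))
  have h2 : bernMean q (fun ω => Real.exp (∑ p, (if ω p then 1 else 0) * u p)) =
      ∏ p, (q p * Real.exp (u p) + (1 - q p)) := by
    simp only [bernMean, bernWeight, Real.exp_sum, ← Finset.prod_mul_distrib]
    simpa using h
  rw [h2, Real.exp_sum]
  refine Finset.prod_le_prod (fun p _ => ?_) (fun p _ => ?_)
  · have := hq p
    have h3 := mul_nonneg this.1 (Real.exp_pos (u p)).le
    linarith [this.2]
  · have := Real.add_one_le_exp (q p * (Real.exp (u p) - 1))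
    linarith

open Classical in
/-- The probability of the event `B` under independent Bernoulli variables with means `q`. -/
noncomputable def bernProb (q : P → ℝ) (B : (P → Bool) → Prop) : ℝ :=
  bernMean q fun ω => if B ω then 1 else 0

/-- The union bound combined with Markov's inequality for the exponential. -/
lemma bernProb_le_sum_exp {ι : Type*} {q : P → ℝ} (hq : ∀ p, q p ∈ Set.Icc (0 : ℝ) 1)
    (s : Finset ι) (X : ι → (P → Bool) → ℝ) {B : (P → Bool) → Prop}
    (hB : ∀ ω, B ω → ∃ i ∈ s, 0 ≤ X i ω) :
    bernProb q B ≤ ∑ i ∈ s, bernMean q (fun ω => Real.exp (X i ω)) := by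
  rw [← bernMean_sum]
  refine bernMean_mono hq fun ω => ?_
  split_ifs with h
  · obtain ⟨i, hi, hX⟩ := hB ω h
    exact (Real.one_le_exp hX).trans
      (Finset.single_le_sum (f := fun i => Real.exp (X i ω)) (fun j _ => (Real.exp_pos _).le) hi)
  · exact Finset.sum_nonneg fun j _ => (Real.exp_pos _).le

open Classical in
lemma bernProb_exists_le {ι : Type*} {q : P → ℝ} (hq : ∀ p, q p ∈ Set.Icc (0 : ℝ) 1)
    (s : Finset ι) (B : ι → (P → Bool) → Prop) :
    bernProb q (fun ω => ∃ i ∈ s, B i ω) ≤ ∑ i ∈ s, bernProb q (B i) := by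
  simp only [bernProb]
  rw [← bernMean_sum]
  refine bernMean_mono hq fun ω => ?_
  have h0 : ∀ i ∈ s, (0 : ℝ) ≤ if B i ω then 1 else 0 := fun i _ => by split_ifs <;> norm_num
  split_ifs with h
  · obtain ⟨i, hi, hB⟩ := h
    have := Finset.single_le_sum h0 hi
    rwa [if_pos hB] at this
  · exact Finset.sum_nonneg h0

lemma bernProb_or_le {q : P → ℝ} (hq : ∀ p, q p ∈ Set.Icc (0 : ℝ) 1)
    (B B' : (P → Bool) → Prop) :
    bernProb q (fun ω => B ω ∨ B' ω) ≤ bernProb q B + bernProb q B' := by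
  simp only [bernProb]
  rw [← bernMean_add]
  refine bernMean_mono hq fun ω => ?_
  by_cases h : B ω <;> by_cases h' : B' ω <;> simp [h, h']

/-- Bounding an expectation separately on an event and on its complement. -/
lemma bernMean_le_add_mul_prob {q : P → ℝ} (hq : ∀ p, q p ∈ Set.Icc (0 : ℝ) 1)
    {f g : (P → Bool) → ℝ} {b : ℝ} (B : (P → Bool) → Prop) (h : ∀ ω, ¬ B ω → f ω ≤ g ω)
    (h' : ∀ ω, f ω ≤ g ω + b) : bernMean q f ≤ bernMean q g + b * bernProb q B := by
  rw [bernProb, ← bernMean_const_mul, ← bernMean_add]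
  refine bernMean_mono hq fun ω => ?_
  split_ifs with hB
  · simpa using h' ω
  · simpa using h ω hB

/-- The second moment of the likelihood ratio of two products of Bernoulli laws. -/
lemma sum_bernWeight_sq_div_le {q r : P → ℝ} (hq : ∀ p, q p ∈ Set.Ioo (0 : ℝ) 1) :
    ∑ ω, bernWeight r ω ^ 2 / bernWeight q ω ≤
      Real.exp (∑ p, (r p - q p) ^ 2 / (q p * (1 - q p))) := by
  have h := sum_prod_bool (fun p b => (if b then r p else 1 - r p) ^ 2 /
    (if b then q p else 1 - q p))
  have h2 : ∑ ω, bernWeight r ω ^ 2 / bernWeight q ω =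
      ∏ p, (r p ^ 2 / q p + (1 - r p) ^ 2 / (1 - q p)) := by
    simp only [bernWeight, ← Finset.prod_pow, ← Finset.prod_div_distrib]
    simpa using h
  rw [h2, Real.exp_sum]
  refine Finset.prod_le_prod (fun p _ => ?_) (fun p _ => ?_)
  · have h0 := (hq p).1
    have h1 : 0 < 1 - q p := by linarith [(hq p).2]
    positivity
  · have h0 := (hq p).1
    have h1 : 0 < 1 - q p := by linarith [(hq p).2]
    have h3 : r p ^ 2 / q p + (1 - r p) ^ 2 / (1 - q p) =
        (r p - q p) ^ 2 / (q p * (1 - q p)) + 1 := by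
      field_simp
      ring
    rw [h3]
    exact Real.add_one_le_exp _

/-- A two-point lower bound: no number computed from the observations is close to both `a` and `b`
when the likelihood ratio has a bounded second moment. -/
lemma bernMean_two_point {q r : P → ℝ} (hq : ∀ p, q p ∈ Set.Ioo (0 : ℝ) 1)
    (hr : ∀ p, r p ∈ Set.Ioo (0 : ℝ) 1) {K : ℝ}
    (hK : ∑ ω, bernWeight r ω ^ 2 / bernWeight q ω ≤ K) (u : (P → Bool) → ℝ) (a b : ℝ) :
    (a - b) ^ 2 / (1 + K) ≤
      bernMean q (fun ω => (u ω - a) ^ 2) + bernMean r (fun ω => (u ω - b) ^ 2) := by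
  have hqp := bernWeight_pos hq
  have hrp := bernWeight_pos hr
  -- With weights Q and R, Cauchy–Schwarz is applied to R² = (QR/(Q+R)) · (R + R²/Q). The left side
  -- sums to 1, and the second factor sums to at most 1 + K.
  have hS : 1 / (1 + K) ≤
      ∑ ω, bernWeight q ω * bernWeight r ω / (bernWeight q ω + bernWeight r ω) := by
    have hK' : ∑ ω, (bernWeight r ω + bernWeight r ω ^ 2 / bernWeight q ω) ≤ 1 + K := by
      rw [Finset.sum_add_distrib, sum_bernWeight]
      linarith
    have hcs := Finset.sum_sq_le_sum_mul_sum_of_sq_le_mul Finset.univ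
      (r := bernWeight r)
      (f := fun ω => bernWeight q ω * bernWeight r ω / (bernWeight q ω + bernWeight r ω))
      (g := fun ω => bernWeight r ω + bernWeight r ω ^ 2 / bernWeight q ω)
      (fun ω _ => by have := hqp ω; have := hrp ω; positivity)
      (fun ω _ => by have := hqp ω; have := hrp ω; positivity)
      (fun ω _ => by
        have := hqp ω; have := hrp ω
        exact le_of_eq (by field_simp))
    rw [sum_bernWeight, one_pow] at hcs
    have h0 : 0 ≤ ∑ ω, bernWeight q ω * bernWeight r ω / (bernWeight q ω + bernWeight r ω) :=
      Finset.sum_nonneg fun ω _ => by have := hqp ω; have := hrp ω; positivity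
    have hKpos : 0 < 1 + K := by
      have : 0 ≤ ∑ ω, bernWeight r ω ^ 2 / bernWeight q ω :=
        Finset.sum_nonneg fun ω _ => by have := hqp ω; positivity
      linarith
    rw [div_le_iff₀ hKpos]
    exact hcs.trans (mul_le_mul_of_nonneg_left hK' h0)
  calc (a - b) ^ 2 / (1 + K) = (a - b) ^ 2 * (1 / (1 + K)) := by ring
    _ ≤ (a - b) ^ 2 *
        ∑ ω, bernWeight q ω * bernWeight r ω / (bernWeight q ω + bernWeight r ω) :=
      mul_le_mul_of_nonneg_left hS (sq_nonneg _)
    _ ≤ _ := by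
      rw [bernMean, bernMean, Finset.mul_sum, ← Finset.sum_add_distrib]
      refine Finset.sum_le_sum fun ω _ => ?_
      have h1 := hqp ω
      have h2 := hrp ω
      rw [← mul_div_assoc, div_le_iff₀ (by positivity)]
      -- The minimum over u of Q(u-a)² + R(u-b)² is QR(a-b)²/(Q+R). After clearing Q + R, the gap is
      -- exactly this square.
      nlinarith [sq_nonneg (bernWeight q ω * (u ω - a) + bernWeight r ω * (u ω - b))]

end BernoulliProduct

/-! ### From the measure-theoretic risk to finite sums. -/

/-- The edge probabilities as a function of the node pairs. -/
def edgeProb {n : ℕ} (θ : Matrix (Fin n) (Fin n) ℝ) (p : NodePair n) : ℝ := θ p.1.1 p.1.2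

lemma edgeLaw_singleton {n : ℕ} {θ : Matrix (Fin n) (Fin n) ℝ}
    (hθ : ∀ i j, θ i j ∈ Set.Icc (0 : ℝ) 1) (ω : NodePair n → Bool) :
    edgeLaw θ {ω} = ENNReal.ofReal (bernWeight (edgeProb θ) ω) := by
  rw [edgeLaw, Measure.pi_singleton, bernWeight, ENNReal.ofReal_prod_of_nonneg]
  · refine Finset.prod_congr rfl fun p _ => ?_
    have h : Set.projIcc (0 : ℝ) 1 zero_le_one (θ p.1.1 p.1.2) = ⟨θ p.1.1 p.1.2, hθ _ _⟩ :=
      Set.projIcc_of_mem _ _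
    rw [h]
    have h0 := (hθ p.1.1 p.1.2).1
    have h1 : 0 ≤ 1 - θ p.1.1 p.1.2 := by linarith [(hθ p.1.1 p.1.2).2]
    cases hω : ω p
    · simp [bernoulliMeasure_def, edgeProb]
      exact (ENNReal.ofReal_eq_coe_nnreal h1).symm
    · simp [bernoulliMeasure_def, edgeProb]
      exact (ENNReal.ofReal_eq_coe_nnreal h0).symm
  · intro p _
    have := hθ p.1.1 p.1.2
    split_ifs
    · exact this.1
    · simp only [edgeProb]; linarith [this.2]

lemma risk_eq {n : ℕ} (est : Estimator n) {θ : Matrix (Fin n) (Fin n) ℝ}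
    (hθ : ∀ i j, θ i j ∈ Set.Icc (0 : ℝ) 1) :
    risk est θ = ENNReal.ofReal
      (bernMean (edgeProb θ) fun ω => opNorm (est (adjacency ω) - θ) ^ 2) := by
  have hq : ∀ p, edgeProb θ p ∈ Set.Icc (0 : ℝ) 1 := fun p => hθ _ _
  rw [risk, lintegral_fintype, bernMean, ENNReal.ofReal_sum_of_nonneg]
  · refine Finset.sum_congr rfl fun ω _ => ?_
    rw [edgeLaw_singleton hθ, ENNReal.ofReal_mul (bernWeight_nonneg hq ω), mul_comm]
  · exact fun ω _ => mul_nonneg (bernWeight_nonneg hq ω) (sq_nonneg _)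

/-! ### Operator norm: test vectors, Frobenius bound, discretisation on an integer grid. -/

section OperatorNorm

variable {n : ℕ}

lemma opNorm_nonneg (M : Matrix (Fin n) (Fin n) ℝ) : 0 ≤ opNorm M := norm_nonneg _

lemma opNorm_add_le (M N : Matrix (Fin n) (Fin n) ℝ) : opNorm (M + N) ≤ opNorm M + opNorm N := by
  simp only [opNorm, map_add]
  exact norm_add_le _ _

lemma sum_mulVec_sq_le (M : Matrix (Fin n) (Fin n) ℝ) (v : Fin n → ℝ) :
    ∑ i, (∑ j, M i j * v j) ^ 2 ≤ opNorm M ^ 2 * ∑ j, v j ^ 2 := by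
  have h := (Matrix.toEuclideanCLM (n := Fin n) (𝕜 := ℝ) M).le_opNorm (WithLp.toLp 2 v)
  have h2 := pow_le_pow_left₀ (norm_nonneg _) h 2
  rw [mul_pow, EuclideanSpace.norm_sq_eq, EuclideanSpace.norm_sq_eq,
    Matrix.toEuclideanCLM_toLp] at h2
  simpa [opNorm, Matrix.mulVec, dotProduct] using h2

lemma opNorm_sq_le_frobenius (M : Matrix (Fin n) (Fin n) ℝ) :
    opNorm M ^ 2 ≤ ∑ i, ∑ j, M i j ^ 2 := by
  have h0 : 0 ≤ ∑ i, ∑ j, M i j ^ 2 := by positivity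
  rw [← Real.sq_sqrt h0]
  refine pow_le_pow_left₀ (opNorm_nonneg M) ?_ 2
  refine ContinuousLinearMap.opNorm_le_bound _ (Real.sqrt_nonneg _) fun x => ?_
  rw [← abs_of_nonneg (norm_nonneg _),
    ← abs_of_nonneg (mul_nonneg (Real.sqrt_nonneg _) (norm_nonneg x)), ← sq_le_sq, mul_pow,
    Real.sq_sqrt h0, EuclideanSpace.norm_sq_eq, EuclideanSpace.norm_sq_eq, Finset.sum_mul]
  refine Finset.sum_le_sum fun i _ => ?_
  have := Finset.sum_mul_sq_le_sq_mul_sq Finset.univ (fun j => M i j) (fun j => x j)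
  simpa [Matrix.ofLp_toEuclideanCLM, Matrix.mulVec, dotProduct] using this

lemma bilin_le (M : Matrix (Fin n) (Fin n) ℝ) (x y : EuclideanSpace ℝ (Fin n)) :
    inner ℝ x (Matrix.toEuclideanCLM (n := Fin n) (𝕜 := ℝ) M y) ≤ ‖x‖ * (opNorm M * ‖y‖) :=
  (real_inner_le_norm _ _).trans
    (mul_le_mul_of_nonneg_left (ContinuousLinearMap.le_opNorm _ _) (norm_nonneg _))

/-- Rounding a vector of the unit ball to the grid of step `1 / (2 √n)`. -/
lemma exists_grid_approx (hn : 0 < n) (x : EuclideanSpace ℝ (Fin n)) (hx : ‖x‖ ≤ 1) :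
    ∃ c : Fin n → ℤ, ∑ i, c i ^ 2 ≤ 9 * (n : ℤ) ∧
      ‖x - WithLp.toLp 2 (fun i => (c i : ℝ) / (2 * √n))‖ ≤ 1 / 4 := by
  have hn' : (0 : ℝ) < n := by exact_mod_cast hn
  have hs : 0 < √(n : ℝ) := Real.sqrt_pos.2 hn'
  have hss : √(n : ℝ) ^ 2 = n := Real.sq_sqrt hn'.le
  have hx2 : ∑ i, x i ^ 2 ≤ 1 := by
    have h := pow_le_pow_left₀ (norm_nonneg x) hx 2
    rw [EuclideanSpace.norm_sq_eq] at h
    simpa using h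
  set c : Fin n → ℤ := fun i => round (2 * √n * x i) with hc
  have hr : ∀ i, |2 * √n * x i - c i| ≤ 1 / 2 := fun i => abs_sub_round _
  refine ⟨c, ?_, ?_⟩
  -- Since |c_i - 2√n x_i| ≤ 1/2, one has c_i² ≤ 2(2√n x_i)² + 1/2. Summing over the unit ball gives
  -- at most 8n + n.
  · have h1 : ∀ i, (c i : ℝ) ^ 2 ≤ 8 * n * x i ^ 2 + 1 := fun i => by
      have h2 := sq_le_sq' (by linarith [abs_le.1 (hr i)]) (abs_le.1 (hr i)).2
      nlinarith [sq_nonneg (2 * (2 * √n * x i) - c i)]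
    have h3 : (∑ i, (c i : ℝ) ^ 2) ≤ 9 * n := by
      calc (∑ i, (c i : ℝ) ^ 2) ≤ ∑ i, (8 * n * x i ^ 2 + 1) := Finset.sum_le_sum fun i _ => h1 i
        _ = 8 * n * ∑ i, x i ^ 2 + n := by
          rw [Finset.sum_add_distrib, ← Finset.mul_sum]; simp
        _ ≤ 9 * n := by nlinarith
    exact_mod_cast h3
  · have h1 : ‖x - WithLp.toLp 2 (fun i => (c i : ℝ) / (2 * √n))‖ ^ 2 ≤ (1 / 4) ^ 2 := by
      rw [EuclideanSpace.norm_sq_eq]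
      have h2 : ∀ i, ‖(x - WithLp.toLp 2 (fun i => (c i : ℝ) / (2 * √n))) i‖ ^ 2 ≤
          1 / (16 * n) := fun i => by
        have h3 := sq_le_sq' (by linarith [abs_le.1 (hr i)]) (abs_le.1 (hr i)).2
        have h4 : x i - (c i : ℝ) / (2 * √n) = (2 * √n * x i - c i) / (2 * √n) := by
          field_simp
        simp only [PiLp.sub_apply, Real.norm_eq_abs, sq_abs]
        rw [h4, div_pow, mul_pow, hss, div_le_div_iff₀ (by positivity) (by positivity)]
        nlinarith
      calc _ ≤ ∑ _i : Fin n, 1 / (16 * (n : ℝ)) := Finset.sum_le_sum fun i _ => h2 i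
        _ = (1 / 4) ^ 2 := by
          simp only [Finset.sum_const, Finset.card_univ, Fintype.card_fin, nsmul_eq_mul]
          field_simp
          norm_num
    exact le_of_sq_le_sq h1 (by norm_num)

/-- The operator norm is controlled by the bilinear form on integer vectors. -/
lemma opNorm_le_of_grid (hn : 0 < n) (M : Matrix (Fin n) (Fin n) ℝ) (B : ℝ)
    (hB : ∀ c f : Fin n → ℤ, ∑ i, c i ^ 2 ≤ 9 * (n : ℤ) → ∑ i, f i ^ 2 ≤ 9 * (n : ℤ) →
      ∑ i, ∑ j, M i j * (c i * f j) ≤ B * (4 * n)) :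
    opNorm M ≤ 16 / 7 * B := by
  have hn' : (0 : ℝ) < n := by exact_mod_cast hn
  have hs : 0 < √(n : ℝ) := Real.sqrt_pos.2 hn'
  have hss : √(n : ℝ) ^ 2 = n := Real.sq_sqrt hn'.le
  set N := opNorm M with hN
  have hN0 : 0 ≤ N := opNorm_nonneg M
  have hB0 : 0 ≤ B := by
    have := hB 0 0 (by simp) (by simp)
    simp only [Pi.zero_apply, Int.cast_zero, mul_zero, Finset.sum_const_zero] at this
    by_contra h
    push Not at h
    nlinarith
  -- Both vectors are replaced by grid points at distance at most 1/4. The first error is at most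
  -- (1/4)(5/4)N, as the grid point may have length 5/4, and the second is at most N/4. Their total
  -- 9N/16 is absorbed on the left, whence the factor 16/7. The 4n in `hB` is the square of the grid
  -- scale 2√n.
  have key : ∀ x y : EuclideanSpace ℝ (Fin n), ‖x‖ ≤ 1 → ‖y‖ ≤ 1 →
      inner ℝ x (Matrix.toEuclideanCLM (n := Fin n) (𝕜 := ℝ) M y) ≤ B + 9 / 16 * N := by
    intro x y hx hy
    obtain ⟨c, hc, hxc⟩ := exists_grid_approx hn x hx
    obtain ⟨f, hf, hyf⟩ := exists_grid_approx hn y hy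
    set x' : EuclideanSpace ℝ (Fin n) := WithLp.toLp 2 (fun i => (c i : ℝ) / (2 * √n)) with hx'
    set y' : EuclideanSpace ℝ (Fin n) := WithLp.toLp 2 (fun i => (f i : ℝ) / (2 * √n)) with hy'
    set T := Matrix.toEuclideanCLM (n := Fin n) (𝕜 := ℝ) M with hT
    have e : inner ℝ x (T y) = inner ℝ x' (T y') + inner ℝ (x - x') (T y') +
        inner ℝ x (T (y - y')) := by
      simp only [map_sub, inner_sub_left, inner_sub_right]; ring
    have hy'n : ‖y'‖ ≤ 5 / 4 := by
      have : y' = y - (y - y') := by abel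
      rw [this]
      linarith [norm_sub_le y (y - y')]
    have h1 : inner ℝ x' (T y') ≤ B := by
      have h2 : inner ℝ x' (T y') = (∑ i, ∑ j, M i j * (c i * f j)) / (4 * n) := by
        rw [hT, Matrix.inner_toEuclideanCLM, Finset.sum_div]
        simp only [dotProduct, Matrix.mulVec, hx', hy']
        refine Finset.sum_congr rfl fun i _ => ?_
        rw [Finset.mul_sum, Finset.sum_div]
        refine Finset.sum_congr rfl fun j _ => ?_
        have h3 : (4 : ℝ) * n = 2 * √n * (2 * √n) := by nlinarith
        rw [h3]
        field_simp
      rw [h2, div_le_iff₀ (by positivity)]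
      exact hB c f hc hf
    have h2 : inner ℝ (x - x') (T y') ≤ 1 / 4 * (N * (5 / 4)) :=
      (bilin_le M _ _).trans (mul_le_mul hxc (mul_le_mul_of_nonneg_left hy'n hN0)
        (mul_nonneg hN0 (norm_nonneg _)) (by norm_num))
    have h3 : inner ℝ x (T (y - y')) ≤ 1 * (N * (1 / 4)) :=
      (bilin_le M _ _).trans (mul_le_mul hx (mul_le_mul_of_nonneg_left hyf hN0)
        (mul_nonneg hN0 (norm_nonneg _)) (by norm_num))
    rw [e]
    linarith
  have hle : N ≤ B + 9 / 16 * N := by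
    refine ContinuousLinearMap.opNorm_le_of_unit_norm (by positivity) fun y hy => ?_
    set T := Matrix.toEuclideanCLM (n := Fin n) (𝕜 := ℝ) M with hT
    by_cases h0 : ‖T y‖ = 0
    · rw [h0]; positivity
    have h := key ((‖T y‖)⁻¹ • T y) y (by
      rw [norm_smul, norm_inv, norm_norm, inv_mul_cancel₀ h0]) hy.le
    rw [real_inner_smul_left, real_inner_self_eq_norm_sq] at h
    calc ‖T y‖ = ‖T y‖⁻¹ * ‖T y‖ ^ 2 := by field_simp
      _ ≤ _ := h
  linarith

end OperatorNorm

/-! ### Double sums over nodes as sums over independent unordered pairs. -/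

section Pairs

variable {n : ℕ}

/-- A double sum over the nodes without diagonal terms is a sum over the node pairs. -/
lemma sum_sum_eq_sum_pairs (g : Fin n → Fin n → ℝ) (hg : ∀ i, g i i = 0) :
    ∑ i, ∑ j, g i j = ∑ p : NodePair n, (g p.1.1 p.1.2 + g p.1.2 p.1.1) := by
  have h1 : ∀ h : Fin n × Fin n → ℝ, ∑ p : NodePair n, h p.1 =
      ∑ i, ∑ j, if j < i then h (i, j) else 0 := fun h => by
    rw [← Finset.sum_subtype (Finset.univ.filter fun p : Fin n × Fin n => p.2 < p.1)
      (by simp) h, Finset.sum_filter, Fintype.sum_prod_type]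
  rw [h1 (fun p => g p.1 p.2 + g p.2 p.1)]
  have h2 : ∀ i j, (if j < i then g i j + g j i else 0) =
      (if j < i then g i j else 0) + (if j < i then g j i else 0) := fun i j => by
    split_ifs <;> simp
  simp only [h2, Finset.sum_add_distrib]
  rw [Finset.sum_comm (f := fun i j => if j < i then g j i else 0), ← Finset.sum_add_distrib]
  refine Finset.sum_congr rfl fun i _ => ?_
  rw [← Finset.sum_add_distrib]
  refine Finset.sum_congr rfl fun j _ => ?_
  rcases lt_trichotomy i j with h | h | h
  · simp [h, h.not_gt]
  · simp [h, hg]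
  · simp [h, h.not_gt]

lemma adjacency_diag (ω : NodePair n → Bool) (i : Fin n) : adjacency ω i i = 0 := by
  simp [adjacency]

lemma adjacency_lower (ω : NodePair n → Bool) (p : NodePair n) :
    adjacency ω p.1.1 p.1.2 = if ω p then 1 else 0 := by
  simp [adjacency, p.2]

lemma adjacency_upper (ω : NodePair n → Bool) (p : NodePair n) :
    adjacency ω p.1.2 p.1.1 = if ω p then 1 else 0 := by
  simp [adjacency, p.2, p.2.not_gt]

lemma adjacency_symm (ω : NodePair n → Bool) (i j : Fin n) :
    adjacency ω i j = adjacency ω j i := by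
  rcases lt_trichotomy i j with h | h | h
  · simp [adjacency, h, h.not_gt]
  · rw [h]
  · simp [adjacency, h, h.not_gt]

lemma adjacency_mem (ω : NodePair n → Bool) (i j : Fin n) :
    adjacency ω i j ∈ Set.Icc (0 : ℝ) 1 := by
  simp only [adjacency, Matrix.of_apply]
  split_ifs <;> simp

lemma sum_adjacency_mul (ω : NodePair n → Bool) (w : Fin n → Fin n → ℝ) :
    ∑ i, ∑ j, adjacency ω i j * w i j =
      ∑ p : NodePair n, (if ω p then 1 else 0) * (w p.1.1 p.1.2 + w p.1.2 p.1.1) := by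
  rw [sum_sum_eq_sum_pairs _ (fun i => by rw [adjacency_diag, zero_mul])]
  refine Finset.sum_congr rfl fun p _ => ?_
  rw [adjacency_lower, adjacency_upper]
  ring

/-- The moment generating function of a weighted sum of the entries of the adjacency matrix. -/
lemma bernMean_exp_adjacency_le {θ : Matrix (Fin n) (Fin n) ℝ}
    (hθ : ∀ i j, θ i j ∈ Set.Icc (0 : ℝ) 1) (w : Fin n → Fin n → ℝ) :
    bernMean (edgeProb θ) (fun ω => Real.exp (∑ i, ∑ j, adjacency ω i j * w i j)) ≤
      Real.exp (∑ p : NodePair n,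
        θ p.1.1 p.1.2 * (Real.exp (w p.1.1 p.1.2 + w p.1.2 p.1.1) - 1)) := by
  simp only [sum_adjacency_mul]
  exact bernMean_exp_le (fun p => hθ _ _) _

end Pairs

/-! ### Minimax lower bound: Assouad's argument on two-block models. -/

section LowerBound

variable {n : ℕ}

/-- The block of a node: the nodes of the first half are in block `false`, the others are placed
by `z`. -/
def nodeBlock (z : Fin n → Bool) (i : Fin n) : Bool := z i && !decide (i.val < n / 2)

/-- The two-block model with within-block probability `a` and between-block probability
`a + δ`. -/
noncomputable def twoBlock (a δ : ℝ) (z : Fin n → Bool) : Matrix (Fin n) (Fin n) ℝ :=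
  Matrix.of fun i j =>
    if i = j then 0 else if nodeBlock z i = nodeBlock z j then a else a + δ

/-- Moving the node `i` to the other block. -/
def flipAt (i : Fin n) (z : Fin n → Bool) : Fin n → Bool := Function.update z i (!z i)

lemma flipAt_involutive (i : Fin n) : Function.Involutive (flipAt i) := fun z => by
  simp [flipAt]

lemma sum_flipAt (i : Fin n) (F : (Fin n → Bool) → ℝ) : ∑ z, F (flipAt i z) = ∑ z, F z :=
  Equiv.sum_comp (flipAt_involutive i).toPerm F

lemma twoBlock_apply_of_ne {a δ : ℝ} (z : Fin n → Bool) {i j : Fin n} (h : i ≠ j) :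
    twoBlock a δ z i j = a ∨ twoBlock a δ z i j = a + δ := by
  simp only [twoBlock, Matrix.of_apply, if_neg h]
  split_ifs <;> simp

lemma twoBlock_mem {a δ β : ℝ} {k : ℕ} (ha : 0 ≤ a) (hδ : 0 ≤ δ) (hβ : a + δ ≤ β) (hβ1 : β ≤ 1)
    (hk : 2 ≤ k) (z : Fin n → Bool) :
    twoBlock a δ z ∈ sparseSpace n β ∩ blockSpace n k := by
  have hmem : ∀ i j, twoBlock a δ z i j ∈ Set.Icc (0 : ℝ) β := fun i j => by
    by_cases h : i = j
    · simp only [twoBlock, Matrix.of_apply, if_pos h, Set.mem_Icc, le_refl, true_and]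
      linarith
    · rcases twoBlock_apply_of_ne (a := a) (δ := δ) z h with h | h <;> rw [h] <;>
        constructor <;> linarith
  have hmem1 : ∀ i j, twoBlock a δ z i j ∈ Set.Icc (0 : ℝ) 1 := fun i j =>
    ⟨(hmem i j).1, (hmem i j).2.trans hβ1⟩
  have hdiag : ∀ i, twoBlock a δ z i i = 0 := fun i => by simp [twoBlock]
  refine ⟨⟨?_, hmem1, hdiag, fun i j => (hmem i j).2⟩, hmem1, hdiag, ?_⟩
  · ext i j
    simp only [Matrix.transpose_apply, twoBlock, Matrix.of_apply, eq_comm]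
  · set e : Bool → Fin k := fun b => if b then ⟨1, by omega⟩ else ⟨0, by omega⟩ with he
    have hinj : ∀ b b', e b = e b' ↔ b = b' := by
      intro b b'
      cases b <;> cases b' <;> simp [he]
    refine ⟨fun i => e (nodeBlock z i), Matrix.of fun s t => if s = t then a else a + δ, ?_, ?_, ?_⟩
    · intro s t
      simp only [Matrix.of_apply]
      split_ifs <;> constructor <;> linarith
    · intro s t
      simp only [Matrix.of_apply, eq_comm]
    · intro i j hij
      simp only [twoBlock, Matrix.of_apply, if_neg hij, hinj]

/-- The block of every node of the first half is known, so for a node outside it this partial row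
sum depends on its own label only. The zero diagonal does not interfere. -/
lemma sum_twoBlock_row {a δ : ℝ} (z : Fin n → Bool) {i : Fin n} (hi : ¬ i.val < n / 2) :
    ∑ j with j.val < n / 2, twoBlock a δ z i j =
      (Finset.univ.filter fun j : Fin n => j.val < n / 2).card * (a + if z i then δ else 0) := by
  rw [← nsmul_eq_mul, ← Finset.sum_const]
  refine Finset.sum_congr rfl fun j hj => ?_
  have hj' : j.val < n / 2 := by simpa using hj
  have hij : i ≠ j := fun h => hi (h ▸ hj')
  simp only [twoBlock, Matrix.of_apply, if_neg hij, nodeBlock, hj', hi]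
  cases z i <;> simp

lemma sum_pairs_incident_le (i : Fin n) :
    ∑ p : NodePair n, (if p.1.1 = i ∨ p.1.2 = i then (1 : ℝ) else 0) ≤ n := by
  have h := sum_sum_eq_sum_pairs (n := n) (fun a b => if a = i ∧ b ≠ i then (1 : ℝ) else 0)
    (fun a => by simp)
  have h2 : ∀ p : NodePair n, (if p.1.1 = i ∨ p.1.2 = i then (1 : ℝ) else 0) =
      (if p.1.1 = i ∧ p.1.2 ≠ i then (1 : ℝ) else 0) +
        (if p.1.2 = i ∧ p.1.1 ≠ i then (1 : ℝ) else 0) := fun p => by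
    have := p.2.ne
    by_cases h1 : p.1.1 = i <;> by_cases h2 : p.1.2 = i <;> simp_all
  simp only [h2, ← h]
  calc ∑ a, ∑ b, (if a = i ∧ b ≠ i then (1 : ℝ) else 0)
      ≤ ∑ a, ∑ _b : Fin n, (if a = i then (1 : ℝ) else 0) := by
        refine Finset.sum_le_sum fun a _ => Finset.sum_le_sum fun b _ => ?_
        by_cases h1 : a = i <;> by_cases h2 : b = i <;> simp [h1, h2]
    _ = n := by simp

/-- The likelihood ratio between the two positions of one node has a bounded second moment. -/
lemma likelihood_flip_le {β δ : ℝ} (hβ : 0 < β) (hβ1 : β ≤ 1) (hδ : 0 ≤ δ) (hδ4 : δ ≤ β / 4)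
    (hδ2 : δ ^ 2 * (16 * n) = β) (z : Fin n → Bool) (i : Fin n) :
    ∑ ω, bernWeight (edgeProb (twoBlock (β / 4) δ (flipAt i z))) ω ^ 2 /
      bernWeight (edgeProb (twoBlock (β / 4) δ z)) ω ≤ 2 := by
  have hn : (0 : ℝ) < n := by exact_mod_cast i.pos
  have hval : ∀ (z : Fin n → Bool) (p : NodePair n),
      edgeProb (twoBlock (β / 4) δ z) p ∈ Set.Icc (β / 4) (1 / 2) := fun z p => by
    rcases twoBlock_apply_of_ne (a := β / 4) (δ := δ) z p.2.ne' with h | h <;>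
      rw [edgeProb, h] <;> constructor <;> linarith
  refine (sum_bernWeight_sq_div_le fun p => ?_).trans ?_
  · constructor <;> linarith [(hval z p).1, (hval z p).2]
  -- With q between β/4 and 1/2, q(1-q) ≥ β/8, so an affected pair costs at most 8δ²/β = 1/(2n). At
  -- most n pairs contain i, so the exponent is at most 1/2 and exp(1/2) ≤ 2.
  have h1 : ∀ p : NodePair n, (edgeProb (twoBlock (β / 4) δ (flipAt i z)) p -
      edgeProb (twoBlock (β / 4) δ z) p) ^ 2 / (edgeProb (twoBlock (β / 4) δ z) p *
        (1 - edgeProb (twoBlock (β / 4) δ z) p)) ≤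
      1 / (2 * n) * if p.1.1 = i ∨ p.1.2 = i then 1 else 0 := fun p => by
    have hv := hval z p
    have hden : β / 8 ≤ edgeProb (twoBlock (β / 4) δ z) p *
        (1 - edgeProb (twoBlock (β / 4) δ z) p) := by
      nlinarith [hv.1, hv.2]
    split_ifs with hp
    · have hnum : (edgeProb (twoBlock (β / 4) δ (flipAt i z)) p -
          edgeProb (twoBlock (β / 4) δ z) p) ^ 2 ≤ δ ^ 2 := by
        rcases twoBlock_apply_of_ne (a := β / 4) (δ := δ) z p.2.ne' with h | h <;>
        rcases twoBlock_apply_of_ne (a := β / 4) (δ := δ) (flipAt i z) p.2.ne' with h' | h' <;>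
        rw [edgeProb, edgeProb, h, h'] <;> nlinarith [sq_nonneg δ]
      rw [mul_one, div_le_div_iff₀ (by linarith) (by positivity)]
      nlinarith
    · push Not at hp
      have : edgeProb (twoBlock (β / 4) δ (flipAt i z)) p = edgeProb (twoBlock (β / 4) δ z) p := by
        have e : ∀ j, j ≠ i → nodeBlock (flipAt i z) j = nodeBlock z j := fun j hj => by
          rw [nodeBlock, nodeBlock, flipAt, Function.update_of_ne hj]
        rw [edgeProb, edgeProb, twoBlock, twoBlock, Matrix.of_apply, Matrix.of_apply, e _ hp.1,
          e _ hp.2]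
      simp [this]
  calc _ ≤ Real.exp (1 / 2) := by
        refine Real.exp_le_exp.2 ((Finset.sum_le_sum fun p _ => h1 p).trans ?_)
        rw [← Finset.mul_sum]
        calc _ ≤ 1 / (2 * n) * (n : ℝ) :=
              mul_le_mul_of_nonneg_left (sum_pairs_incident_le i) (by positivity)
          _ = 1 / 2 := by field_simp
    _ ≤ 2 := by
        have h := Real.exp_one_lt_d9
        have h2 : Real.exp (1 / 2) ^ 2 = Real.exp 1 := by
          rw [← Real.exp_nat_mul]; norm_num
        nlinarith [Real.exp_pos (1 / 2)]

/-- The average of the risks over the positions of the nodes of the second half. -/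
lemma sum_risk_twoBlock_ge {β δ : ℝ} (hn : 2 ≤ n) (hβ : 0 < β) (hβ1 : β ≤ 1) (hδ : 0 ≤ δ)
    (hδ4 : δ ≤ β / 4) (hδ2 : δ ^ 2 * (16 * n) = β) (est : Estimator n) :
    ∑ _z : Fin n → Bool, β * n / 768 ≤ ∑ z : Fin n → Bool,
      bernMean (edgeProb (twoBlock (β / 4) δ z))
        (fun ω => opNorm (est (adjacency ω) - twoBlock (β / 4) δ z) ^ 2) := by
  have hn' : (0 : ℝ) < n := by exact_mod_cast (by omega : 0 < n)
  set S := Finset.univ.filter fun j : Fin n => j.val < n / 2 with hS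
  set T := Finset.univ.filter fun j : Fin n => ¬ j.val < n / 2 with hT
  have hScard : S.card = n / 2 := by
    rw [hS, Fin.card_filter_val_lt]; omega
  have hTcard : S.card + T.card = n := by
    rw [hS, hT, Finset.card_filter_add_card_filter_not]; simp
  have hSpos : (0 : ℝ) < S.card := by
    rw [hScard]; exact_mod_cast (by omega : 0 < n / 2)
  have hST : (n : ℝ) ^ 2 / 8 ≤ S.card * T.card := by
    have h1 : (n : ℝ) / 2 ≤ T.card := by
      rw [div_le_iff₀ two_pos]; exact_mod_cast (by omega : n ≤ T.card * 2)
    have h2 : (n : ℝ) / 4 ≤ S.card := by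
      rw [div_le_iff₀ (by norm_num)]; exact_mod_cast (by omega : n ≤ S.card * 4)
    nlinarith
  have hq : ∀ (z : Fin n → Bool) (p : NodePair n),
      edgeProb (twoBlock (β / 4) δ z) p ∈ Set.Ioo (0 : ℝ) 1 := fun z p => by
    rcases twoBlock_apply_of_ne (a := β / 4) (δ := δ) z p.2.ne' with h | h <;>
      rw [edgeProb, h] <;> constructor <;> linarith
  set U : Fin n → (NodePair n → Bool) → ℝ := fun i ω => ∑ j ∈ S, est (adjacency ω) i j with hU
  set v : Bool → ℝ := fun b => S.card * (β / 4 + if b then δ else 0) with hv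
  set F : Fin n → (Fin n → Bool) → ℝ := fun i z =>
    bernMean (edgeProb (twoBlock (β / 4) δ z)) (fun ω => (U i ω - v (z i)) ^ 2) with hF
  -- The test vector is the indicator of S, of squared length |S|. It reduces the matrix problem to
  -- estimating each row sum `v (z i)` by the number `U i`.
  have hpoint : ∀ z, (∑ i ∈ T, F i z) / S.card ≤ bernMean (edgeProb (twoBlock (β / 4) δ z))
        (fun ω => opNorm (est (adjacency ω) - twoBlock (β / 4) δ z) ^ 2) := fun z => by
    rw [div_le_iff₀ hSpos, mul_comm, ← bernMean_const_mul, hF, ← bernMean_sum]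
    refine bernMean_mono (fun p => Set.Ioo_subset_Icc_self (hq z p)) fun ω => ?_
    have h := sum_mulVec_sq_le (est (adjacency ω) - twoBlock (β / 4) δ z)
      (fun j => if j ∈ S then 1 else 0)
    have h1 : ∑ j : Fin n, (if j ∈ S then (1 : ℝ) else 0) ^ 2 = S.card := by
      simp [ite_pow]
    rw [h1] at h
    calc ∑ i ∈ T, (U i ω - v (z i)) ^ 2 = ∑ i ∈ T, (∑ j,
          (est (adjacency ω) - twoBlock (β / 4) δ z) i j * if j ∈ S then 1 else 0) ^ 2 := by
          refine Finset.sum_congr rfl fun i hi => ?_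
          have hi' : ¬ i.val < n / 2 := by simpa [hT] using hi
          simp only [mul_ite, mul_one, mul_zero, Finset.sum_ite_mem, Finset.univ_inter,
            Matrix.sub_apply, Finset.sum_sub_distrib]
          rw [sum_twoBlock_row z hi']
      _ ≤ ∑ i, (∑ j,
          (est (adjacency ω) - twoBlock (β / 4) δ z) i j * if j ∈ S then 1 else 0) ^ 2 :=
          Finset.sum_le_sum_of_subset_of_nonneg (Finset.subset_univ _) fun _ _ _ => sq_nonneg _
      _ ≤ _ := by rw [mul_comm]; exact h
  -- The two-point bound with K = 2 gives the factor 1/3. Averaging over z counts each pair twice,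
  -- hence the 1/6 below.
  have hpair : ∀ i z, (S.card * δ) ^ 2 / 3 ≤ F i z + F i (flipAt i z) := fun i z => by
    have h := bernMean_two_point (hq z) (hq (flipAt i z))
      (likelihood_flip_le hβ hβ1 hδ hδ4 hδ2 z i) (U i) (v (z i)) (v (flipAt i z i))
    refine le_trans (le_of_eq ?_) h
    simp only [flipAt, Function.update_self, hv]
    cases z i <;> simp <;> ring
  have hsum : ∀ i, ∑ _z : Fin n → Bool, (S.card * δ) ^ 2 / 6 ≤ ∑ z, F i z := fun i => by
    have h := Finset.sum_le_sum fun z (_ : z ∈ Finset.univ) => hpair i z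
    rw [Finset.sum_add_distrib, sum_flipAt] at h
    have h2 : ∑ _z : Fin n → Bool, ((S.card : ℝ) * δ) ^ 2 / 6 =
        (∑ _z : Fin n → Bool, (S.card * δ) ^ 2 / 3) / 2 := by
      rw [Finset.sum_div]; exact Finset.sum_congr rfl fun _ _ => by ring
    rw [h2]; linarith
  refine le_trans ?_ (Finset.sum_le_sum fun z _ => hpoint z)
  rw [← Finset.sum_div Finset.univ (fun z => ∑ i ∈ T, F i z),
    Finset.sum_comm (f := fun z i => F i z)]
  refine le_trans ?_ (div_le_div_of_nonneg_right (Finset.sum_le_sum fun i _ => hsum i) hSpos.le)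
  simp only [Finset.sum_const, nsmul_eq_mul]
  -- 768 = 8 · 16 · 6, from |S||T| ≥ n²/8, δ² = β/(16n) and the averaged two-point bound.
  have h3 : β * n / 768 ≤ T.card * ((S.card * δ) ^ 2 / 6) / S.card := by
    have : T.card * ((S.card * δ) ^ 2 / 6) / S.card = S.card * T.card * δ ^ 2 / 6 := by
      field_simp
    rw [this]
    have h4 : δ ^ 2 = β / (16 * n) := by field_simp; linarith
    calc β * n / 768 = (n : ℝ) ^ 2 / 8 * δ ^ 2 / 6 := by rw [h4]; field_simp; norm_num
      _ ≤ _ := by gcongr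
  calc _ ≤ ((Finset.univ : Finset (Fin n → Bool)).card : ℝ) *
        (T.card * ((S.card * δ) ^ 2 / 6) / S.card) := mul_le_mul_of_nonneg_left h3 (by positivity)
    _ = _ := by ring

/-- The lower bound for the minimax risk over the block models. -/
lemma le_minimaxRisk {k : ℕ} {β : ℝ} (hn : 2 ≤ n) (hk : 2 ≤ k) (hβ : (n : ℝ)⁻¹ ≤ β)
    (hβ1 : β ≤ 1) :
    ENNReal.ofReal (β * n / 768) ≤ minimaxRisk (sparseSpace n β ∩ blockSpace n k) := by
  have hn' : (0 : ℝ) < n := by exact_mod_cast (by omega : 0 < n)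
  have hβ0 : 0 < β := (inv_pos.2 hn').trans_le hβ
  set δ := √(β / (16 * n)) with hδdef
  have hδ : 0 ≤ δ := Real.sqrt_nonneg _
  have hδsq : δ ^ 2 = β / (16 * n) := Real.sq_sqrt (by positivity)
  have hδ2 : δ ^ 2 * (16 * n) = β := by rw [hδsq]; field_simp
  -- This is where βn ≥ 1 matters: δ² = β/(16n) ≤ β²/16.
  have hδ4 : δ ≤ β / 4 := by
    refine le_of_sq_le_sq ?_ (by positivity)
    have h1 : 1 ≤ β * n := by
      have := mul_le_mul_of_nonneg_right hβ hn'.le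
      rwa [inv_mul_cancel₀ hn'.ne'] at this
    rw [hδsq, div_le_iff₀ (by positivity)]
    nlinarith
  refine le_iInf fun est => ?_
  obtain ⟨z, -, hz⟩ := Finset.exists_le_of_sum_le Finset.univ_nonempty
    (sum_risk_twoBlock_ge hn hβ0 hβ1 hδ hδ4 hδ2 est)
  have hmem := twoBlock_mem (n := n) (a := β / 4) (δ := δ) (β := β) (by positivity) hδ
    (by linarith) hβ1 hk z
  refine le_trans ?_ (le_iSup₂_of_le (twoBlock (β / 4) δ z) hmem le_rfl)
  rw [risk_eq est hmem.2.1]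
  exact ENNReal.ofReal_le_ofReal hz

end LowerBound

/-! ### Deterministic summation over pairs of dyadic levels. -/

section LevelSums

/-- The growing denominator does not spoil the geometric sum: it remains comparable to its last
term. The gain 1/(1+N) later cancels the level-dependent entropy. -/
lemma sum_two_pow_div_le (N : ℕ) :
    ∑ k ∈ Finset.range (N + 1), (2 : ℝ) ^ k / (1 + k) ≤ 4 * 2 ^ N / (1 + N) := by
  induction N with
  | zero => norm_num
  | succ N ih =>
    rw [Finset.sum_range_succ]
    -- The inductive comparison amounts to 4/(1+N) ≤ 6/(2+N), which fails at N = 0.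
    rcases Nat.eq_zero_or_pos N with h | h
    · subst h; norm_num
    · have hN : (1 : ℝ) ≤ N := by exact_mod_cast h
      have h2 : (4 : ℝ) * 2 ^ N / (1 + N) + 2 ^ (N + 1) / (1 + ↑(N + 1)) ≤
          4 * 2 ^ (N + 1) / (1 + ↑(N + 1)) := by
        push_cast
        rw [pow_succ, div_add_div _ _ (by positivity) (by positivity),
          div_le_div_iff₀ (by positivity) (by positivity)]
        have hp : (0 : ℝ) < 2 ^ N := by positivity
        have h3 : (4 * 2 ^ N * (1 + ((N : ℝ) + 1)) + (1 + N) * (2 ^ N * 2)) ≤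
            4 * (2 ^ N * 2) * (1 + N) := by nlinarith
        nlinarith [mul_le_mul_of_nonneg_right h3 (by positivity : (0 : ℝ) ≤ 1 + ((N : ℝ) + 1))]
      linarith

/-- For fixed t, the index k = s + t - m determines s, and s ≤ t + m forces k ≤ 2t. The sum is thus
dominated by k = 2t. -/
lemma sum_balanced_levels_le (N m t : ℕ) :
    ∑ s ∈ Finset.range N, (if m ≤ s + t ∧ s ≤ t + m then
      (2 : ℝ) ^ (s + t) / (1 + (s + t - m : ℕ)) else 0) ≤ 4 * 2 ^ m * 4 ^ t / (1 + 2 * t) := by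
  rw [← Finset.sum_filter]
  set F := (Finset.range N).filter fun s => m ≤ s + t ∧ s ≤ t + m with hF
  calc ∑ s ∈ F, (2 : ℝ) ^ (s + t) / (1 + (s + t - m : ℕ))
      = ∑ s ∈ F, 2 ^ m * ((2 : ℝ) ^ (s + t - m) / (1 + (s + t - m : ℕ))) := by
        refine Finset.sum_congr rfl fun s hs => ?_
        have h : m ≤ s + t := (Finset.mem_filter.1 hs).2.1
        rw [← mul_div_assoc, ← pow_add, Nat.add_sub_cancel' h]
    _ = 2 ^ m * ∑ k ∈ F.image (fun s => s + t - m), (2 : ℝ) ^ k / (1 + k) := by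
        rw [Finset.sum_image, Finset.mul_sum]
        intro a ha b hb hab
        have ha' : m ≤ a + t := (Finset.mem_filter.1 ha).2.1
        have hb' : m ≤ b + t := (Finset.mem_filter.1 hb).2.1
        simp only at hab
        omega
    _ ≤ 2 ^ m * ∑ k ∈ Finset.range (2 * t + 1), (2 : ℝ) ^ k / (1 + k) := by
        refine mul_le_mul_of_nonneg_left (Finset.sum_le_sum_of_subset_of_nonneg ?_ ?_)
          (by positivity)
        · intro k hk
          obtain ⟨s, hs, rfl⟩ := Finset.mem_image.1 hk
          have h := (Finset.mem_filter.1 hs).2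
          rw [Finset.mem_range]
          omega
        · intros; positivity
    _ ≤ 2 ^ m * (4 * 2 ^ (2 * t) / (1 + (2 * t : ℕ))) :=
        mul_le_mul_of_nonneg_left (sum_two_pow_div_le _) (by positivity)
    _ = _ := by
        rw [pow_mul]; push_cast; norm_num; ring

/-- A geometric sum over t < s - m, which is at most 2^(s-m). The gap m between the levels becomes
the gain 2^(-m). -/
lemma sum_unbalanced_levels_le (N m s : ℕ) :
    ∑ t ∈ Finset.range N, (if t + m < s then (2 : ℝ) ^ (s + t) else 0) ≤ 4 ^ s / 2 ^ m := by
  rw [← Finset.sum_filter]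
  have hsub : ((Finset.range N).filter fun t => t + m < s) ⊆ Finset.range (s - m) := by
    intro t ht
    have := (Finset.mem_filter.1 ht).2
    rw [Finset.mem_range]; omega
  rcases le_or_gt s m with h | h
  · have : ((Finset.range N).filter fun t => t + m < s) = ∅ :=
      Finset.filter_eq_empty_iff.2 fun t _ => by omega
    rw [this, Finset.sum_empty]; positivity
  calc _ ≤ ∑ t ∈ Finset.range (s - m), (2 : ℝ) ^ (s + t) :=
        Finset.sum_le_sum_of_subset_of_nonneg hsub fun _ _ _ => by positivity
    _ = 2 ^ s * ∑ t ∈ Finset.range (s - m), (2 : ℝ) ^ t := by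
        rw [Finset.mul_sum]; simp [pow_add]
    _ ≤ 2 ^ s * 2 ^ (s - m) := by
        refine mul_le_mul_of_nonneg_left ?_ (by positivity)
        rw [geom_sum_eq (by norm_num)]
        norm_num
    _ = 4 ^ s / 2 ^ m := by
        rw [eq_div_iff (by positivity), mul_assoc, ← pow_add, Nat.sub_add_cancel h.le, ← mul_pow]
        norm_num

lemma sum_inv_four_pow_le (N : ℕ) : ∑ t ∈ Finset.range N, ((4 : ℝ) ^ t)⁻¹ ≤ 2 := by
  have h : ∀ N, ∑ t ∈ Finset.range N, ((4 : ℝ) ^ t)⁻¹ ≤ 2 - 2 * ((4 : ℝ) ^ N)⁻¹ := fun N => by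
    induction N with
    | zero => norm_num
    | succ N ih =>
      rw [Finset.sum_range_succ, pow_succ, mul_inv]
      have : (0 : ℝ) < ((4 : ℝ) ^ N)⁻¹ := by positivity
      linarith
  have : (0 : ℝ) < ((4 : ℝ) ^ N)⁻¹ := by positivity
  linarith [h N]

/-- The contribution of the entropy terms to the sum over the heavy levels. -/
lemma sum_entropy_levels_le (N m : ℕ) {n Q : ℝ} (hn : 0 ≤ n) (T : ℕ → ℝ) (hT : ∀ t, 0 ≤ T t)
    (hQ : ∑ t ∈ Finset.range N, 4 ^ t * T t ≤ Q) :
    ∑ t ∈ Finset.range N, ∑ s ∈ Finset.range N, (if m ≤ s + t ∧ s ≤ t + m then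
      (2 : ℝ) ^ (s + t) / (1 + (s + t - m : ℕ)) else 0) * (24 * (t * T t + n / 16 ^ t)) ≤
      96 * 2 ^ m * (Q + 2 * n) := by
  calc _ ≤ ∑ t ∈ Finset.range N, 96 * 2 ^ m * (4 ^ t * T t + n * ((4 : ℝ) ^ t)⁻¹) := by
        refine Finset.sum_le_sum fun t _ => ?_
        have hTt := hT t
        rw [← Finset.sum_mul]
        refine (mul_le_mul_of_nonneg_right (sum_balanced_levels_le N m t)
          (by positivity)).trans ?_
        rw [div_mul_eq_mul_div, div_le_iff₀ (by positivity)]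
        -- The denominator 1 + 2t absorbs the factor t of the entropy, and 4^t/16^t leaves a
        -- summable 4^(-t).
        have h1 : (16 : ℝ) ^ t = 4 ^ t * 4 ^ t := by rw [← mul_pow]; norm_num
        have h2 : 4 * 2 ^ m * 4 ^ t * (24 * (t * T t + n / 16 ^ t)) =
            96 * 2 ^ m * (4 ^ t * T t * t + n * ((4 : ℝ) ^ t)⁻¹) := by
          rw [h1]; field_simp; ring
        rw [h2, mul_assoc (96 * (2 : ℝ) ^ m)]
        refine mul_le_mul_of_nonneg_left ?_ (by positivity)
        have h3 : 0 ≤ 4 ^ t * T t := by positivity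
        have h4 : 0 ≤ n * ((4 : ℝ) ^ t)⁻¹ := by positivity
        have h5 : (0 : ℝ) ≤ t := by positivity
        nlinarith [mul_nonneg h3 h5, mul_nonneg h4 h5]
    _ = 96 * 2 ^ m * (∑ t ∈ Finset.range N, 4 ^ t * T t +
        n * ∑ t ∈ Finset.range N, ((4 : ℝ) ^ t)⁻¹) := by
        rw [← Finset.mul_sum, Finset.sum_add_distrib, Finset.mul_sum _ _ n]
    _ ≤ _ := by
        refine mul_le_mul_of_nonneg_left ?_ (by positivity)
        nlinarith [sum_inv_four_pow_le N]

/-- The contribution of the degree bounds to the sum over the heavy levels. -/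
lemma sum_degree_levels_le (N m : ℕ) {D Q : ℝ} (hD : 0 ≤ D) (S : ℕ → ℝ) (hS : ∀ t, 0 ≤ S t)
    (hQ : ∑ s ∈ Finset.range N, 4 ^ s * S s ≤ Q) :
    ∑ s ∈ Finset.range N, ∑ t ∈ Finset.range N, (if t + m < s then (2 : ℝ) ^ (s + t) else 0) *
      (D * S s) ≤ D * Q / 2 ^ m := by
  calc _ ≤ ∑ s ∈ Finset.range N, D / 2 ^ m * (4 ^ s * S s) := by
        refine Finset.sum_le_sum fun s _ => ?_
        have := hS s
        rw [← Finset.sum_mul]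
        refine (mul_le_mul_of_nonneg_right (sum_unbalanced_levels_le N m s)
          (by positivity)).trans (le_of_eq (by ring))
    _ ≤ D / 2 ^ m * Q := by
        rw [← Finset.mul_sum]
        exact mul_le_mul_of_nonneg_left hQ (by positivity)
    _ = _ := by ring

/-- The sum over the heavy pairs of levels, from the degree bounds `hdeg`, `hdeg'` and the
discrepancy bound `hdisc`. -/
lemma sum_heavy_levels_le (N m : ℕ) {n Q D β : ℝ} (hn : 0 ≤ n) (hD : 0 ≤ D) (hβ : 0 ≤ β)
    (hQ0 : 0 ≤ Q) (S T : ℕ → ℝ) (hS : ∀ t, 0 ≤ S t) (hT : ∀ t, 0 ≤ T t) (e : ℕ → ℕ → ℝ)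
    (hSQ : ∑ s ∈ Finset.range N, 4 ^ s * S s ≤ Q) (hTQ : ∑ t ∈ Finset.range N, 4 ^ t * T t ≤ Q)
    (hdeg : ∀ s t, e s t ≤ D * S s) (hdeg' : ∀ s t, e s t ≤ D * T t)
    (hdisc : ∀ s ∈ Finset.range N, ∀ t ∈ Finset.range N, m ≤ s + t →
      (1 + (s + t - m : ℕ)) * e s t ≤ 3 * 2 ^ (1 + (s + t - m)) * β * (S s * T t) +
        24 * (s * S s + n / 16 ^ s) + 24 * (t * T t + n / 16 ^ t)) :
    ∑ s ∈ Finset.range N, ∑ t ∈ Finset.range N, (if m ≤ s + t then 2 ^ (s + t) * e s t else 0) ≤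
      2 * (D * Q / 2 ^ m) + 6 * β * Q ^ 2 / 2 ^ m + 192 * 2 ^ m * (Q + 2 * n) := by
  -- Three regimes: if one level exceeds the other by more than m, the degree bound on the set of
  -- the higher level suffices. Otherwise |s - t| ≤ m and the discrepancy bound is used, producing
  -- the last three terms.
  have hpoint : ∀ s ∈ Finset.range N, ∀ t ∈ Finset.range N,
      (if m ≤ s + t then 2 ^ (s + t) * e s t else 0) ≤
      (if t + m < s then (2 : ℝ) ^ (s + t) else 0) * (D * S s) +
      (if s + m < t then (2 : ℝ) ^ (t + s) else 0) * (D * T t) +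
      6 * β / 2 ^ m * ((4 ^ s * S s) * (4 ^ t * T t)) +
      (if m ≤ s + t ∧ s ≤ t + m then (2 : ℝ) ^ (s + t) / (1 + (s + t - m : ℕ)) else 0) *
        (24 * (t * T t + n / 16 ^ t)) +
      (if m ≤ t + s ∧ t ≤ s + m then (2 : ℝ) ^ (t + s) / (1 + (t + s - m : ℕ)) else 0) *
        (24 * (s * S s + n / 16 ^ s)) := by
    intro s hs t ht
    have hSs := hS s
    have hTt := hT t
    have p1 : 0 ≤ (if t + m < s then (2 : ℝ) ^ (s + t) else 0) * (D * S s) := by positivity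
    have p2 : 0 ≤ (if s + m < t then (2 : ℝ) ^ (t + s) else 0) * (D * T t) := by positivity
    have p3 : 0 ≤ 6 * β / 2 ^ m * ((4 ^ s * S s) * (4 ^ t * T t)) := by positivity
    have p4 : 0 ≤ (if m ≤ s + t ∧ s ≤ t + m then (2 : ℝ) ^ (s + t) / (1 + (s + t - m : ℕ))
      else 0) * (24 * (t * T t + n / 16 ^ t)) := by positivity
    have p5 : 0 ≤ (if m ≤ t + s ∧ t ≤ s + m then (2 : ℝ) ^ (t + s) / (1 + (t + s - m : ℕ))
      else 0) * (24 * (s * S s + n / 16 ^ s)) := by positivity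
    by_cases hm : m ≤ s + t
    swap
    · rw [if_neg hm]; positivity
    rw [if_pos hm]
    by_cases h1 : t + m < s
    · have : (2 : ℝ) ^ (s + t) * e s t ≤ 2 ^ (s + t) * (D * S s) :=
        mul_le_mul_of_nonneg_left (hdeg s t) (by positivity)
      rw [if_pos h1] at p1 ⊢
      linarith
    by_cases h2 : s + m < t
    · have : (2 : ℝ) ^ (s + t) * e s t ≤ 2 ^ (t + s) * (D * T t) := by
        rw [add_comm t s]
        exact mul_le_mul_of_nonneg_left (hdeg' s t) (by positivity)
      rw [if_pos h2] at p2 ⊢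
      linarith
    have hm' : m ≤ t + s := by omega
    rw [if_neg h1, if_neg h2, zero_mul, zero_mul, if_pos (⟨hm, by omega⟩ : m ≤ s + t ∧ s ≤ t + m),
      if_pos (⟨hm', by omega⟩ : m ≤ t + s ∧ t ≤ s + m), add_comm t s]
    -- Division by a is discarded in the main term, where 2^(1+s+t-m) already matches 4^s · 4^t /
    -- 2^m after multiplication by 2^(s+t). It is kept in the two entropy terms, which need it.
    set a : ℝ := 1 + (s + t - m : ℕ) with ha
    have ha1 : 1 ≤ a := by rw [ha]; linarith [(Nat.cast_nonneg (s + t - m) : (0 : ℝ) ≤ _)]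
    have hd := hdisc s hs t ht hm
    have hpow : (2 : ℝ) ^ (1 + (s + t - m)) = 2 * 2 ^ (s + t) / 2 ^ m := by
      rw [eq_div_iff (by positivity), ← pow_succ', ← pow_add]
      congr 1
      omega
    have h4 : (4 : ℝ) ^ s * 4 ^ t = 2 ^ (s + t) * 2 ^ (s + t) := by
      rw [← pow_add, ← mul_pow]; norm_num
    have key : (2 : ℝ) ^ (s + t) * e s t ≤ 2 ^ (s + t) / a *
        (3 * 2 ^ (1 + (s + t - m)) * β * (S s * T t) +
        24 * (s * S s + n / 16 ^ s) + 24 * (t * T t + n / 16 ^ t)) := by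
      calc (2 : ℝ) ^ (s + t) * e s t = 2 ^ (s + t) / a * (a * e s t) := by
            field_simp
        _ ≤ _ := mul_le_mul_of_nonneg_left hd (by positivity)
    have hmain : 2 ^ (s + t) / a * (3 * 2 ^ (1 + (s + t - m)) * β * (S s * T t)) ≤
        6 * β / 2 ^ m * ((4 ^ s * S s) * (4 ^ t * T t)) := by
      have e1 : 6 * β / 2 ^ m * ((4 ^ s * S s) * (4 ^ t * T t)) =
          2 ^ (s + t) * (3 * 2 ^ (1 + (s + t - m)) * β * (S s * T t)) := by
        rw [hpow]
        calc _ = 6 * β / 2 ^ m * (((4 : ℝ) ^ s * 4 ^ t) * (S s * T t)) := by ring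
          _ = _ := by rw [h4]; ring
      rw [e1]
      refine mul_le_mul_of_nonneg_right (div_le_self (by positivity) ha1) (by positivity)
    rw [mul_add, mul_add] at key
    linarith
  refine (Finset.sum_le_sum fun s hs => Finset.sum_le_sum fun t ht => hpoint s hs t ht).trans ?_
  simp only [Finset.sum_add_distrib]
  have b1 := sum_degree_levels_le N m hD S hS hSQ
  have b2 := sum_degree_levels_le N m hD T hT hTQ
  rw [Finset.sum_comm] at b2
  have b3 : ∑ s ∈ Finset.range N, ∑ t ∈ Finset.range N,
      6 * β / 2 ^ m * ((4 ^ s * S s) * (4 ^ t * T t)) ≤ 6 * β * Q ^ 2 / 2 ^ m := by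
    simp only [← Finset.mul_sum]
    rw [← Finset.sum_mul]
    have h0 : 0 ≤ ∑ t ∈ Finset.range N, 4 ^ t * T t :=
      Finset.sum_nonneg fun t _ => mul_nonneg (by positivity) (hT t)
    calc _ ≤ 6 * β / 2 ^ m * (Q * Q) :=
          mul_le_mul_of_nonneg_left (mul_le_mul hSQ hTQ h0 hQ0) (by positivity)
      _ = _ := by ring
  have b4 := sum_entropy_levels_le N m hn T hT hTQ
  rw [Finset.sum_comm] at b4
  have b5 := sum_entropy_levels_le N m hn S hS hSQ
  linarith

end LevelSums

/-! ### Dyadic decomposition of integer vectors. -/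

section Levels

variable {n : ℕ}

/-- The dyadic level of a coordinate of an integer vector. -/
def level (c : Fin n → ℤ) (i : Fin n) : ℕ := Nat.log 2 (c i).natAbs

/-- The nonzero coordinates of a given dyadic level. -/
def levelSet (c : Fin n → ℤ) (s : ℕ) : Finset (Fin n) :=
  Finset.univ.filter fun i => c i ≠ 0 ∧ level c i = s

/-- A zero coordinate also has level 0, because `Nat.log 2 0 = 0`. It must be excluded here and in
`levelSet`, but not in the upper bound below. -/
lemma two_pow_level_le {c : Fin n → ℤ} {i : Fin n} (h : c i ≠ 0) :
    (2 : ℝ) ^ level c i ≤ |(c i : ℝ)| := by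
  have h1 := Nat.pow_log_le_self 2 (x := (c i).natAbs) (by simpa using h)
  have h2 : ((2 ^ Nat.log 2 (c i).natAbs : ℕ) : ℝ) ≤ ((c i).natAbs : ℝ) := by exact_mod_cast h1
  rw [Nat.cast_natAbs] at h2
  push_cast at h2
  exact h2

lemma abs_le_two_pow_level (c : Fin n → ℤ) (i : Fin n) :
    |(c i : ℝ)| ≤ 2 ^ (level c i + 1) := by
  have h1 := Nat.lt_pow_succ_log_self one_lt_two (c i).natAbs
  have h2 : ((c i).natAbs : ℝ) ≤ ((2 ^ (Nat.log 2 (c i).natAbs + 1) : ℕ) : ℝ) := by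
    exact_mod_cast h1.le
  rw [Nat.cast_natAbs] at h2
  push_cast at h2
  exact h2

lemma four_pow_level_le {c : Fin n → ℤ} {i : Fin n} (h : c i ≠ 0) :
    (4 : ℝ) ^ level c i ≤ (c i : ℝ) ^ 2 := by
  have := pow_le_pow_left₀ (by positivity) (two_pow_level_le h) 2
  rw [sq_abs, ← pow_mul, mul_comm, pow_mul] at this
  norm_num at this
  exact this

/-- A crude consequence of 9n < 16 · 4^n. It suffices because the union bound over levels can afford
polynomially many pairs. -/
lemma level_lt {c : Fin n → ℤ} (hc : ∑ i, c i ^ 2 ≤ 9 * (n : ℤ)) {i : Fin n} (h : c i ≠ 0) :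
    level c i < n + 2 := by
  have h1 := four_pow_level_le h
  have h2 : (c i : ℝ) ^ 2 ≤ 9 * n := by
    have : c i ^ 2 ≤ 9 * (n : ℤ) :=
      (Finset.single_le_sum (f := fun i => c i ^ 2) (fun j _ => sq_nonneg (c j))
        (Finset.mem_univ i)).trans hc
    exact_mod_cast this
  have h3 : (n : ℝ) ≤ 4 ^ n := by exact_mod_cast (Nat.lt_pow_self (by norm_num)).le
  by_contra hlt
  push Not at hlt
  have h4 : (4 : ℝ) ^ (n + 2) ≤ 4 ^ level c i := pow_le_pow_right₀ (by norm_num) hlt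
  rw [pow_add] at h4
  have h5 : (0 : ℝ) < 4 ^ n := by positivity
  nlinarith

lemma sum_levelSet {N : ℕ} {c : Fin n → ℤ} (hN : ∀ i, c i ≠ 0 → level c i < N) (F : Fin n → ℝ)
    (hF : ∀ i, c i = 0 → F i = 0) :
    ∑ i, F i = ∑ s ∈ Finset.range N, ∑ i ∈ levelSet c s, F i := by
  have h1 : ∑ i, F i = ∑ i with c i ≠ 0, F i := by
    rw [Finset.sum_filter]
    refine Finset.sum_congr rfl fun i _ => ?_
    by_cases h : c i = 0 <;> simp [h, hF]
  rw [h1, ← Finset.sum_fiberwise_of_maps_to (t := Finset.range N) (g := level c)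
    (fun i hi => Finset.mem_range.2 (hN i (by simpa using hi)))]
  refine Finset.sum_congr rfl fun s _ => ?_
  rw [levelSet, Finset.filter_filter]

lemma sum_four_pow_card_levelSet_le {N : ℕ} {c : Fin n → ℤ}
    (hc : ∑ i, c i ^ 2 ≤ 9 * (n : ℤ)) (hN : ∀ i, c i ≠ 0 → level c i < N) :
    ∑ s ∈ Finset.range N, (4 : ℝ) ^ s * (levelSet c s).card ≤ 9 * n := by
  have hc' : ∑ i, (c i : ℝ) ^ 2 ≤ 9 * n := by exact_mod_cast hc
  rw [sum_levelSet hN (fun i => (c i : ℝ) ^ 2) (fun i h => by simp [h])] at hc'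
  refine le_trans (Finset.sum_le_sum fun s _ => ?_) hc'
  rw [mul_comm, ← nsmul_eq_mul, ← Finset.sum_const]
  refine Finset.sum_le_sum fun i hi => ?_
  obtain ⟨h1, h2⟩ := (Finset.mem_filter.1 hi).2
  rw [← h2]
  exact four_pow_level_le h1

/-- The heavy part of a nonnegative bilinear form in terms of the sums over pairs of levels. -/
lemma sum_heavy_le {N : ℕ} (m : ℕ) {c f : Fin n → ℤ} (hcN : ∀ i, c i ≠ 0 → level c i < N)
    (hfN : ∀ i, f i ≠ 0 → level f i < N) (W : Fin n → Fin n → ℝ) (hW : ∀ i j, 0 ≤ W i j) :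
    ∑ i, ∑ j, W i j * (if m ≤ level c i + level f j then |(c i * f j : ℝ)| else 0) ≤
      4 * ∑ s ∈ Finset.range N, ∑ t ∈ Finset.range N,
        (if m ≤ s + t then 2 ^ (s + t) * ∑ i ∈ levelSet c s, ∑ j ∈ levelSet f t, W i j else 0) := by
  rw [sum_levelSet hcN _ (fun i h => by simp [h]), Finset.mul_sum]
  refine Finset.sum_le_sum fun s _ => ?_
  have h1 : ∀ i ∈ levelSet c s,
      ∑ j, W i j * (if m ≤ level c i + level f j then |(c i * f j : ℝ)| else 0) =
      ∑ t ∈ Finset.range N, ∑ j ∈ levelSet f t,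
        W i j * (if m ≤ level c i + level f j then |(c i * f j : ℝ)| else 0) := fun i _ =>
    sum_levelSet hfN _ (fun j h => by simp [h])
  rw [Finset.sum_congr rfl h1, Finset.sum_comm, Finset.mul_sum]
  refine Finset.sum_le_sum fun t _ => ?_
  have h2 : 4 * (if m ≤ s + t then 2 ^ (s + t) * ∑ i ∈ levelSet c s, ∑ j ∈ levelSet f t, W i j
      else 0) = ∑ i ∈ levelSet c s, ∑ j ∈ levelSet f t,
        W i j * (if m ≤ s + t then (2 : ℝ) ^ (s + 1) * 2 ^ (t + 1) else 0) := by
    simp only [← Finset.sum_mul]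
    split_ifs
    · rw [pow_add, pow_succ, pow_succ]; ring
    · ring
  rw [h2]
  refine Finset.sum_le_sum fun i hi => Finset.sum_le_sum fun j hj => ?_
  refine mul_le_mul_of_nonneg_left ?_ (hW i j)
  have hi' := (Finset.mem_filter.1 hi).2.2
  have hj' := (Finset.mem_filter.1 hj).2.2
  rw [hi', hj']
  split_ifs
  · rw [abs_mul, ← hi', ← hj']
    exact mul_le_mul (abs_le_two_pow_level c i) (abs_le_two_pow_level f j) (abs_nonneg _)
      (by positivity)
  · exact le_rfl

end Levels

/-! ### Bernstein bound and union over the grid for the light products. -/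

section Concentration

variable {n : ℕ}

lemma sum_pairs_le (g : Fin n → Fin n → ℝ) (hg : ∀ i j, 0 ≤ g i j) :
    ∑ p : NodePair n, (g p.1.1 p.1.2 + g p.1.2 p.1.1) ≤ ∑ i, ∑ j, g i j := by
  have h := sum_sum_eq_sum_pairs (fun i j => if i = j then 0 else g i j) (fun i => by simp)
  have h2 : ∑ p : NodePair n, (g p.1.1 p.1.2 + g p.1.2 p.1.1) =
      ∑ i, ∑ j, (if i = j then 0 else g i j) := by
    rw [h]
    refine Finset.sum_congr rfl fun p _ => ?_
    rw [if_neg p.2.ne', if_neg p.2.ne]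
  rw [h2]
  refine Finset.sum_le_sum fun i _ => Finset.sum_le_sum fun j _ => ?_
  split_ifs
  · exact hg i j
  · exact le_rfl

/-- Bernstein's exponential moment bound for the noise. -/
lemma bernMean_exp_noise_le {θ : Matrix (Fin n) (Fin n) ℝ} {β L V : ℝ} (hθ : θ ∈ sparseSpace n β)
    (hβ : 0 ≤ β) (w : Fin n → Fin n → ℝ) (hL : 0 < L) (hw : ∀ i j, |w i j + w j i| ≤ L)
    (hV : ∑ i, ∑ j, w i j ^ 2 ≤ V) :
    bernMean (edgeProb θ)
      (fun ω => Real.exp (L⁻¹ * ∑ i, ∑ j, (adjacency ω i j - θ i j) * w i j)) ≤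
      Real.exp (2 * β * V / L ^ 2) := by
  obtain ⟨hsymm, hmem, hdiag, hle⟩ := hθ
  have hq : ∀ p, edgeProb θ p ∈ Set.Icc (0 : ℝ) 1 := fun p => hmem _ _
  have hsplit : ∀ ω, Real.exp (L⁻¹ * ∑ i, ∑ j, (adjacency ω i j - θ i j) * w i j) =
      Real.exp (-(∑ p : NodePair n, θ p.1.1 p.1.2 *
        (L⁻¹ * (w p.1.1 p.1.2 + w p.1.2 p.1.1)))) *
        Real.exp (∑ i, ∑ j, adjacency ω i j * (L⁻¹ * w i j)) := fun ω => by
    rw [← Real.exp_add]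
    congr 1
    have h1 : ∑ p : NodePair n, θ p.1.1 p.1.2 * (L⁻¹ * (w p.1.1 p.1.2 + w p.1.2 p.1.1)) =
        ∑ i, ∑ j, θ i j * (L⁻¹ * w i j) := by
      rw [sum_sum_eq_sum_pairs _ (fun i => by rw [hdiag, zero_mul])]
      refine Finset.sum_congr rfl fun p _ => ?_
      rw [← hsymm.apply p.1.1 p.1.2]
      ring
    rw [h1, Finset.mul_sum, ← Finset.sum_neg_distrib, ← Finset.sum_add_distrib]
    refine Finset.sum_congr rfl fun i _ => ?_
    rw [Finset.mul_sum, ← Finset.sum_neg_distrib, ← Finset.sum_add_distrib]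
    exact Finset.sum_congr rfl fun j _ => by ring
  simp only [hsplit]
  rw [bernMean_const_mul]
  refine (mul_le_mul_of_nonneg_left (bernMean_exp_adjacency_le hmem _)
    (Real.exp_pos _).le).trans ?_
  rw [← Real.exp_add]
  refine Real.exp_le_exp.2 ?_
  rw [← Finset.sum_neg_distrib, ← Finset.sum_add_distrib]
  -- After centring, only exp(x) - 1 - x ≤ x² for |x| ≤ 1 is needed. The two orientations of a pair
  -- share one indicator, hence (a+b)² ≤ 2(a²+b²).
  have hpt : ∀ p : NodePair n,
      -(θ p.1.1 p.1.2 * (L⁻¹ * (w p.1.1 p.1.2 + w p.1.2 p.1.1))) + θ p.1.1 p.1.2 *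
        (Real.exp (L⁻¹ * w p.1.1 p.1.2 + L⁻¹ * w p.1.2 p.1.1) - 1) ≤
      2 * β / L ^ 2 * (w p.1.1 p.1.2 ^ 2 + w p.1.2 p.1.1 ^ 2) := fun p => by
    set a := w p.1.1 p.1.2
    set b := w p.1.2 p.1.1
    have hab : |L⁻¹ * (a + b)| ≤ 1 := by
      rw [abs_mul, abs_of_pos (inv_pos.2 hL), inv_mul_le_iff₀ hL, mul_one]
      exact hw _ _
    have he := (abs_le.1 (Real.abs_exp_sub_one_sub_id_le hab)).2
    rw [← mul_add]
    calc _ = θ p.1.1 p.1.2 * (Real.exp (L⁻¹ * (a + b)) - 1 - L⁻¹ * (a + b)) := by ring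
      _ ≤ θ p.1.1 p.1.2 * (L⁻¹ * (a + b)) ^ 2 := mul_le_mul_of_nonneg_left he (hmem _ _).1
      _ ≤ β * (L⁻¹ * (a + b)) ^ 2 := mul_le_mul_of_nonneg_right (hle _ _) (sq_nonneg _)
      _ = β / L ^ 2 * (a + b) ^ 2 := by field_simp
      _ ≤ β / L ^ 2 * (2 * (a ^ 2 + b ^ 2)) := by
        refine mul_le_mul_of_nonneg_left ?_ (by positivity)
        nlinarith [sq_nonneg (a - b)]
      _ = _ := by ring
  calc _ ≤ ∑ p : NodePair n, 2 * β / L ^ 2 * (w p.1.1 p.1.2 ^ 2 + w p.1.2 p.1.1 ^ 2) :=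
        Finset.sum_le_sum fun p _ => hpt p
    _ ≤ 2 * β / L ^ 2 * V := by
        rw [← Finset.mul_sum]
        exact mul_le_mul_of_nonneg_left
          ((sum_pairs_le (fun i j => w i j ^ 2) fun i j => sq_nonneg _).trans hV) (by positivity)
    _ = _ := by ring

/-- The integer vectors of squared length at most `9 n`. -/
noncomputable def gridBall (n : ℕ) : Finset (Fin n → ℤ) :=
  (Fintype.piFinset fun _ : Fin n => Finset.Icc (-(9 * n : ℤ)) (9 * n)).filter
    fun c => ∑ i, c i ^ 2 ≤ 9 * (n : ℤ)

lemma mem_gridBall {c : Fin n → ℤ} : c ∈ gridBall n ↔ ∑ i, c i ^ 2 ≤ 9 * (n : ℤ) := by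
  refine ⟨fun h => (Finset.mem_filter.1 h).2, fun h => Finset.mem_filter.2 ⟨?_, h⟩⟩
  rw [Fintype.mem_piFinset]
  intro i
  have h1 : c i ^ 2 ≤ 9 * (n : ℤ) :=
    (Finset.single_le_sum (f := fun i => c i ^ 2) (fun j _ => sq_nonneg (c j))
      (Finset.mem_univ i)).trans h
  have h2 := Int.natAbs_le_self_sq (c i)
  rw [Finset.mem_Icc]
  have h3 := abs_le.1 (Int.abs_eq_natAbs (c i) ▸ h2.trans h1)
  exact h3

lemma sum_half_pow_natAbs_le (N : ℕ) :
    ∑ k ∈ Finset.Icc (-(N : ℤ)) N, (1 / 2 : ℝ) ^ k.natAbs ≤ 3 - 2 * (1 / 2) ^ N := by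
  induction N with
  | zero => norm_num
  | succ N ih =>
    have h : Finset.Icc (-((N + 1 : ℕ) : ℤ)) ((N + 1 : ℕ) : ℤ) =
        insert (-((N + 1 : ℕ) : ℤ)) (insert ((N + 1 : ℕ) : ℤ) (Finset.Icc (-(N : ℤ)) N)) := by
      ext k
      simp only [Finset.mem_Icc, Finset.mem_insert]
      push_cast
      omega
    rw [h, Finset.sum_insert, Finset.sum_insert]
    · rw [Int.natAbs_neg, Int.natAbs_natCast, pow_succ]
      linarith
    · simp
    · simp only [Finset.mem_insert, Finset.mem_Icc]
      push_cast
      omega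

/-- Counting by an exponential weight: for integers |c_i| ≤ c_i², so every grid vector satisfies 1 ≤
2^(9n) ∏ 2^(-|c_i|). The weights sum to at most 3 per coordinate, and 2^9 · 3 ≤ e^11. -/
lemma card_gridBall_le (n : ℕ) : ((gridBall n).card : ℝ) ≤ Real.exp (11 * n) := by
  have h1 : ∀ c ∈ gridBall n, (1 : ℝ) ≤ 2 ^ (9 * n) * ∏ i, (1 / 2 : ℝ) ^ (c i).natAbs := by
    intro c hc
    have h2 : ∑ i, (c i).natAbs ≤ 9 * n := by
      have h3 : ((∑ i, (c i).natAbs : ℕ) : ℤ) ≤ ∑ i, c i ^ 2 := by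
        push_cast
        refine Finset.sum_le_sum fun i _ => ?_
        have := Int.natAbs_le_self_sq (c i)
        rwa [Int.natCast_natAbs] at this
      exact_mod_cast h3.trans (mem_gridBall.1 hc)
    rw [Finset.prod_pow_eq_pow_sum, one_div, inv_pow, ← div_eq_mul_inv,
      one_le_div (by positivity)]
    exact pow_le_pow_right₀ (by norm_num) h2
  calc ((gridBall n).card : ℝ) = ∑ c ∈ gridBall n, (1 : ℝ) := by simp
    _ ≤ ∑ c ∈ gridBall n, 2 ^ (9 * n) * ∏ i, (1 / 2 : ℝ) ^ (c i).natAbs := Finset.sum_le_sum h1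
    _ ≤ ∑ c ∈ Fintype.piFinset fun _ : Fin n => Finset.Icc (-(9 * n : ℤ)) (9 * n),
        2 ^ (9 * n) * ∏ i, (1 / 2 : ℝ) ^ (c i).natAbs :=
        Finset.sum_le_sum_of_subset_of_nonneg (Finset.filter_subset _ _)
          fun _ _ _ => by positivity
    _ = 2 ^ (9 * n) * ∏ _i : Fin n,
        ∑ k ∈ Finset.Icc (-(9 * n : ℤ)) (9 * n), (1 / 2 : ℝ) ^ k.natAbs := by
        rw [← Finset.mul_sum, Finset.prod_univ_sum]
    _ ≤ 2 ^ (9 * n) * ∏ _i : Fin n, 3 := by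
        refine mul_le_mul_of_nonneg_left (Finset.prod_le_prod (fun i _ => ?_) fun i _ => ?_)
          (by positivity)
        · exact Finset.sum_nonneg fun _ _ => by positivity
        · have := sum_half_pow_natAbs_le (9 * n)
          push_cast at this
          have h0 : (0 : ℝ) ≤ 2 * (1 / 2) ^ (9 * n) := by positivity
          linarith
    _ = (2 ^ 9 * 3) ^ n := by simp [pow_mul, mul_pow]
    _ ≤ Real.exp 11 ^ n := by
        refine pow_le_pow_left₀ (by norm_num) ?_ n
        have h2 : (2.7 : ℝ) ≤ Real.exp 1 := by linarith [Real.exp_one_gt_d9]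
        calc (2 : ℝ) ^ 9 * 3 ≤ 2.7 ^ 11 := by norm_num
          _ ≤ Real.exp 1 ^ 11 := pow_le_pow_left₀ (by norm_num) h2 11
          _ = Real.exp 11 := by rw [← Real.exp_nat_mul]; norm_num
    _ = Real.exp (11 * n) := by rw [← Real.exp_nat_mul]; ring_nf

/-- The light part of the product of two integer vectors. -/
noncomputable def lightPart (m : ℕ) (c f : Fin n → ℤ) (i j : Fin n) : ℝ :=
  if level c i + level f j < m then (c i * f j : ℝ) else 0

lemma abs_lightPart_le (m : ℕ) (c f : Fin n → ℤ) (i j : Fin n) :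
    |lightPart m c f i j| ≤ 2 * 2 ^ m := by
  rw [lightPart]
  split_ifs with h
  · rw [abs_mul]
    calc _ ≤ (2 : ℝ) ^ (level c i + 1) * 2 ^ (level f j + 1) :=
          mul_le_mul (abs_le_two_pow_level c i) (abs_le_two_pow_level f j) (abs_nonneg _)
            (by positivity)
      _ ≤ 2 ^ (m + 1) := by
          rw [← pow_add]
          exact pow_le_pow_right₀ (by norm_num) (by omega)
      _ = _ := by ring
  · rw [abs_zero]; positivity

lemma sum_mul_sq_le {c f : Fin n → ℤ} (hc : ∑ i, c i ^ 2 ≤ 9 * (n : ℤ))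
    (hf : ∑ i, f i ^ 2 ≤ 9 * (n : ℤ)) : ∑ i, ∑ j, (c i * f j : ℝ) ^ 2 ≤ 81 * n ^ 2 := by
  have hc' : ∑ i, (c i : ℝ) ^ 2 ≤ 9 * n := by exact_mod_cast hc
  have hf' : ∑ i, (f i : ℝ) ^ 2 ≤ 9 * n := by exact_mod_cast hf
  simp only [mul_pow]
  rw [← Finset.sum_mul_sum]
  have h0 : 0 ≤ ∑ i, (f i : ℝ) ^ 2 := Finset.sum_nonneg fun _ _ => sq_nonneg _
  calc _ ≤ (9 * n : ℝ) * (9 * n) := mul_le_mul hc' hf' h0 (by positivity)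
    _ = _ := by ring

/-- With high probability the light part of the noise is small on all integer vectors. -/
lemma prob_light_le {θ : Matrix (Fin n) (Fin n) ℝ} {β : ℝ} {m : ℕ} (hθ : θ ∈ sparseSpace n β)
    (hβ : 0 ≤ β) (hm : β * n ≤ 4 * 4 ^ m) :
    bernProb (edgeProb θ) (fun ω => ∃ c ∈ gridBall n, ∃ f ∈ gridBall n,
      256 * n * 2 ^ m < ∑ i, ∑ j, (adjacency ω i j - θ i j) * lightPart m c f i j) ≤
      Real.exp (-n) := by
  set L : ℝ := 4 * 2 ^ m with hL
  have hL0 : 0 < L := by positivity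
  refine (bernProb_le_sum_exp (fun p => hθ.2.1 _ _) (gridBall n ×ˢ gridBall n)
    (fun cf ω => L⁻¹ * (∑ i, ∑ j, (adjacency ω i j - θ i j) * lightPart m cf.1 cf.2 i j) -
      64 * n) ?_).trans ?_
  · rintro ω ⟨c, hc, f, hf, h⟩
    refine ⟨(c, f), Finset.mem_product.2 ⟨hc, hf⟩, ?_⟩
    have : 64 * n = L⁻¹ * (256 * n * 2 ^ m) := by rw [hL]; field_simp; ring
    rw [sub_nonneg, this]
    exact mul_le_mul_of_nonneg_left h.le (by positivity)
  -- The scale L = 4 · 2^m bounds both orientations together. The variance exponent is at most 41n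
  -- and the threshold 256n · 2^m is 64n · L, leaving -23n, which beats the 22n from the two grids.
  have hpt : ∀ cf ∈ gridBall n ×ˢ gridBall n, bernMean (edgeProb θ) (fun ω => Real.exp
      (L⁻¹ * (∑ i, ∑ j, (adjacency ω i j - θ i j) * lightPart m cf.1 cf.2 i j) - 64 * n)) ≤
      Real.exp (-(23 * n)) := by
    intro cf hcf
    obtain ⟨hc, hf⟩ := Finset.mem_product.1 hcf
    have h := bernMean_exp_noise_le (L := L) (V := 81 * n ^ 2) hθ hβ (lightPart m cf.1 cf.2) hL0
      (fun i j => (abs_add_le _ _).trans (by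
        rw [hL]
        linarith [abs_lightPart_le m cf.1 cf.2 i j, abs_lightPart_le m cf.1 cf.2 j i]))
      (le_trans (Finset.sum_le_sum fun i _ => Finset.sum_le_sum fun j _ => by
        rw [lightPart]
        split_ifs
        · exact le_rfl
        · rw [zero_pow two_ne_zero]; exact sq_nonneg _)
        (sum_mul_sq_le (mem_gridBall.1 hc) (mem_gridBall.1 hf)))
    have e : ∀ x : ℝ, Real.exp (x - 64 * n) = Real.exp (-(64 * n)) * Real.exp x := fun x => by
      rw [← Real.exp_add]; congr 1; ring
    simp only [e]
    rw [bernMean_const_mul]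
    refine (mul_le_mul_of_nonneg_left h (Real.exp_pos _).le).trans ?_
    rw [← Real.exp_add]
    refine Real.exp_le_exp.2 ?_
    have h41 : 2 * β * (81 * n ^ 2) / L ^ 2 ≤ 41 * n := by
      have e2 : (4 : ℝ) ^ m = (2 ^ m) ^ 2 := by rw [← pow_mul, mul_comm, pow_mul]; norm_num
      rw [div_le_iff₀ (by positivity), hL, mul_pow, ← e2]
      nlinarith [mul_le_mul_of_nonneg_left hm (Nat.cast_nonneg n : (0 : ℝ) ≤ n),
        mul_nonneg (Nat.cast_nonneg n : (0 : ℝ) ≤ n) (by positivity : (0 : ℝ) ≤ 4 ^ m)]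
    linarith
  refine (Finset.sum_le_sum hpt).trans ?_
  rw [Finset.sum_const, Finset.card_product, nsmul_eq_mul, Nat.cast_mul]
  have hcard := card_gridBall_le n
  calc _ ≤ Real.exp (11 * n) * Real.exp (11 * n) * Real.exp (-(23 * n)) := by gcongr
    _ = Real.exp (-n) := by rw [← Real.exp_add, ← Real.exp_add]; congr 1; ring

/-! ### Discrepancy of edge counts and degree tails. -/

/-- The number of edges between two sets of nodes. -/
def edgeCount (ω : NodePair n → Bool) (S T : Finset (Fin n)) : ℝ :=
  ∑ i ∈ S, ∑ j ∈ T, adjacency ω i j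

lemma edgeCount_eq (ω : NodePair n → Bool) (S T : Finset (Fin n)) :
    edgeCount ω S T = ∑ i, ∑ j, adjacency ω i j * if i ∈ S ∧ j ∈ T then 1 else 0 := by
  simp only [edgeCount, mul_ite, mul_one, mul_zero, ite_and, Finset.sum_ite_mem,
    Finset.univ_inter, Finset.sum_ite_irrel, Finset.sum_const_zero]

/-- The tilt is half of a · log 2 because an edge with both ends in S ∩ T is counted twice; even
then its exponential factor is only 2^a. -/
lemma bernMean_exp_edgeCount_le {θ : Matrix (Fin n) (Fin n) ℝ} {β : ℝ}
    (hθ : θ ∈ sparseSpace n β) (hβ : 0 ≤ β) (a : ℕ) (S T : Finset (Fin n)) :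
    bernMean (edgeProb θ) (fun ω => Real.exp (a / 2 * Real.log 2 * edgeCount ω S T)) ≤
      Real.exp (2 ^ a * β * (S.card * T.card)) := by
  set l : ℝ := a / 2 * Real.log 2 with hl
  have hl0 : 0 ≤ l := mul_nonneg (by positivity) (Real.log_nonneg (by norm_num))
  have hexp : Real.exp (2 * l) = 2 ^ a := by
    rw [hl, show 2 * ((a : ℝ) / 2 * Real.log 2) = a * Real.log 2 by ring, Real.exp_nat_mul,
      Real.exp_log (by norm_num)]
  set w : Fin n → Fin n → ℝ := fun i j => if i ∈ S ∧ j ∈ T then 1 else 0 with hw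
  have e1 : ∀ ω, l * edgeCount ω S T = ∑ i, ∑ j, adjacency ω i j * (l * w i j) := fun ω => by
    rw [edgeCount_eq, Finset.mul_sum]
    refine Finset.sum_congr rfl fun i _ => ?_
    rw [Finset.mul_sum]
    exact Finset.sum_congr rfl fun j _ => by ring
  simp only [e1]
  refine (bernMean_exp_adjacency_le hθ.2.1 _).trans (Real.exp_le_exp.2 ?_)
  have hw01 : ∀ i j, w i j = 0 ∨ w i j = 1 := fun i j => by
    simp only [hw]; split_ifs <;> simp
  have hpt : ∀ p : NodePair n, θ p.1.1 p.1.2 *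
      (Real.exp (l * w p.1.1 p.1.2 + l * w p.1.2 p.1.1) - 1) ≤
      2 ^ a * β * (w p.1.1 p.1.2 + w p.1.2 p.1.1) := fun p => by
    have hu : Real.exp (l * w p.1.1 p.1.2 + l * w p.1.2 p.1.1) - 1 ≤
        2 ^ a * (w p.1.1 p.1.2 + w p.1.2 p.1.1) := by
      have hpow : (0 : ℝ) < 2 ^ a := by positivity
      have h1 : Real.exp l ≤ 2 ^ a := by
        rw [← hexp]; exact Real.exp_le_exp.2 (by linarith)
      rcases hw01 p.1.1 p.1.2 with h | h <;> rcases hw01 p.1.2 p.1.1 with h' | h' <;>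
        rw [h, h'] <;> simp only [mul_zero, mul_one, add_zero, zero_add, Real.exp_zero]
      · simp
      · linarith
      · linarith
      · rw [← two_mul, hexp]; linarith
    have hw0 : 0 ≤ w p.1.1 p.1.2 + w p.1.2 p.1.1 := by
      rcases hw01 p.1.1 p.1.2 with h | h <;> rcases hw01 p.1.2 p.1.1 with h' | h' <;>
        rw [h, h'] <;> norm_num
    calc _ ≤ θ p.1.1 p.1.2 * (2 ^ a * (w p.1.1 p.1.2 + w p.1.2 p.1.1)) :=
          mul_le_mul_of_nonneg_left hu (hθ.2.1 _ _).1
      _ ≤ β * (2 ^ a * (w p.1.1 p.1.2 + w p.1.2 p.1.1)) :=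
          mul_le_mul_of_nonneg_right (hθ.2.2.2 _ _) (by positivity)
      _ = _ := by ring
  calc _ ≤ ∑ p : NodePair n, 2 ^ a * β * (w p.1.1 p.1.2 + w p.1.2 p.1.1) :=
        Finset.sum_le_sum fun p _ => hpt p
    _ ≤ 2 ^ a * β * ∑ i, ∑ j, w i j := by
        rw [← Finset.mul_sum]
        refine mul_le_mul_of_nonneg_left (sum_pairs_le w fun i j => ?_) (by positivity)
        rcases hw01 i j with h | h <;> simp [h]
    _ = _ := by
        simp [hw, ite_and]

/-- The entropy penalty of a set of `k` nodes at the dyadic level `t`. -/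
noncomputable def entropyPenalty (n t k : ℕ) : ℝ := 3 * (k * (t * Real.log 16) + n / 16 ^ t)

/-- With q = 16^(-t) each term is (q^k exp(-nq))³. One factor sums over all subsets to (1+q)^n
exp(-nq) ≤ 1 by the binomial theorem. Each of the other two is at most 1/n, since k ≥ 1 and nq ≤
exp(nq). -/
lemma sum_exp_neg_entropyPenalty_le (hn : 0 < n) (t : ℕ) :
    ∑ T : Finset (Fin n) with T.Nonempty, Real.exp (-entropyPenalty n t T.card) ≤
      1 / (n : ℝ) ^ 2 := by
  have hn' : (0 : ℝ) < n := by exact_mod_cast hn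
  set q : ℝ := (16 ^ t)⁻¹ with hq
  have hq0 : 0 < q := by positivity
  have hq1 : q ≤ 1 := inv_le_one_of_one_le₀ (one_le_pow₀ (by norm_num))
  have hexp : ∀ k : ℕ, Real.exp (-entropyPenalty n t k) = (q ^ k * Real.exp (-(n * q))) ^ 3 := by
    intro k
    have h1 : q ^ k = Real.exp (-(k * (t * Real.log 16))) := by
      rw [Real.exp_neg, Real.exp_nat_mul, Real.exp_nat_mul, Real.exp_log (by norm_num), hq, inv_pow]
    rw [h1, ← Real.exp_add, ← Real.exp_nat_mul, entropyPenalty, hq]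
    congr 1
    push_cast
    ring
  have hsmall : ∀ T : Finset (Fin n), T.Nonempty →
      Real.exp (-entropyPenalty n t T.card) ≤
        1 / (n : ℝ) ^ 2 * (q ^ T.card * Real.exp (-(n * q))) := by
    intro T hT
    rw [hexp]
    have h1 : q ^ T.card * Real.exp (-(n * q)) ≤ 1 / n := by
      have h2 : q ^ T.card ≤ q := by
        simpa using pow_le_pow_of_le_one hq0.le hq1 hT.card_pos
      have h3 : n * q ≤ Real.exp (n * q) := by linarith [Real.add_one_le_exp (n * q)]
      rw [le_div_iff₀ hn', Real.exp_neg]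
      calc q ^ T.card * (Real.exp (n * q))⁻¹ * n ≤ q * (Real.exp (n * q))⁻¹ * n := by gcongr
        _ = n * q / Real.exp (n * q) := by rw [div_eq_mul_inv]; ring
        _ ≤ 1 := (div_le_one (Real.exp_pos _)).2 h3
    have h0 : 0 ≤ q ^ T.card * Real.exp (-(n * q)) := by positivity
    calc (q ^ T.card * Real.exp (-(n * q))) ^ 3 =
          (q ^ T.card * Real.exp (-(n * q))) ^ 2 * (q ^ T.card * Real.exp (-(n * q))) := by ring
      _ ≤ (1 / (n : ℝ)) ^ 2 * (q ^ T.card * Real.exp (-(n * q))) := by gcongr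
      _ = _ := by rw [div_pow, one_pow]
  calc _ ≤ ∑ T : Finset (Fin n) with T.Nonempty,
        1 / (n : ℝ) ^ 2 * (q ^ T.card * Real.exp (-(n * q))) :=
        Finset.sum_le_sum fun T hT => hsmall T (Finset.mem_filter.1 hT).2
    _ ≤ ∑ T : Finset (Fin n), 1 / (n : ℝ) ^ 2 * (q ^ T.card * Real.exp (-(n * q))) :=
        Finset.sum_le_sum_of_subset_of_nonneg (Finset.filter_subset _ _)
          fun _ _ _ => by positivity
    _ = 1 / (n : ℝ) ^ 2 * ((q + 1) ^ n * Real.exp (-(n * q))) := by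
        rw [← Finset.mul_sum, ← Finset.sum_mul]
        have h := Finset.sum_pow_mul_eq_add_pow q 1 (Finset.univ : Finset (Fin n))
        simp only [one_pow, mul_one, Finset.card_univ, Fintype.card_fin,
          Finset.powerset_univ] at h
        rw [h]
    _ ≤ 1 / (n : ℝ) ^ 2 * (Real.exp (n * q) * Real.exp (-(n * q))) := by
        have h := pow_le_pow_left₀ (by positivity) (Real.add_one_le_exp q) n
        rw [← Real.exp_nat_mul] at h
        gcongr
    _ = _ := by rw [← Real.exp_add]; simp

/-- The discrepancy property at the levels `s`, `t`: no two sets span too many edges. -/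
def Discrepancy (β : ℝ) (m s t : ℕ) (ω : NodePair n → Bool) : Prop :=
  ∀ S T : Finset (Fin n), S.Nonempty → T.Nonempty →
    ((1 + (s + t - m) : ℕ) : ℝ) / 2 * Real.log 2 * edgeCount ω S T ≤
      2 ^ (1 + (s + t - m)) * β * (S.card * T.card) +
        entropyPenalty n s S.card + entropyPenalty n t T.card

/-- With high probability the discrepancy property holds at all relevant levels. -/
lemma prob_discrepancy_le {θ : Matrix (Fin n) (Fin n) ℝ} {β : ℝ} (m : ℕ) (hn : 2 ≤ n)
    (hθ : θ ∈ sparseSpace n β) (hβ : 0 ≤ β) :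
    bernProb (edgeProb θ) (fun ω => ∃ s ∈ Finset.range (n + 2), ∃ t ∈ Finset.range (n + 2),
      ¬ Discrepancy β m s t ω) ≤ 4 / (n : ℝ) ^ 2 := by
  have hn' : (2 : ℝ) ≤ n := by exact_mod_cast hn
  set E : Finset (Finset (Fin n)) := Finset.univ.filter Finset.Nonempty with hE
  refine (bernProb_le_sum_exp (fun p => hθ.2.1 _ _)
    ((Finset.range (n + 2) ×ˢ Finset.range (n + 2)) ×ˢ (E ×ˢ E))
    (fun x ω => ((1 + (x.1.1 + x.1.2 - m) : ℕ) : ℝ) / 2 * Real.log 2 * edgeCount ω x.2.1 x.2.2 -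
      (2 ^ (1 + (x.1.1 + x.1.2 - m)) * β * (x.2.1.card * x.2.2.card) +
        entropyPenalty n x.1.1 x.2.1.card + entropyPenalty n x.1.2 x.2.2.card)) ?_).trans ?_
  · rintro ω ⟨s, hs, t, ht, h⟩
    simp only [Discrepancy] at h
    push Not at h
    obtain ⟨S, T, hS, hT, h⟩ := h
    refine ⟨((s, t), (S, T)), ?_, ?_⟩
    · simp only [Finset.mem_product, hE, Finset.mem_filter, Finset.mem_univ, true_and]
      exact ⟨⟨hs, ht⟩, hS, hT⟩
    · exact sub_nonneg.2 h.le
  have hpt : ∀ x : (ℕ × ℕ) × (Finset (Fin n) × Finset (Fin n)),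
      bernMean (edgeProb θ) (fun ω => Real.exp
        (((1 + (x.1.1 + x.1.2 - m) : ℕ) : ℝ) / 2 * Real.log 2 * edgeCount ω x.2.1 x.2.2 -
      (2 ^ (1 + (x.1.1 + x.1.2 - m)) * β * (x.2.1.card * x.2.2.card) +
        entropyPenalty n x.1.1 x.2.1.card + entropyPenalty n x.1.2 x.2.2.card))) ≤
      Real.exp (-entropyPenalty n x.1.1 x.2.1.card) *
        Real.exp (-entropyPenalty n x.1.2 x.2.2.card) := by
    intro x
    have h := bernMean_exp_edgeCount_le hθ hβ (1 + (x.1.1 + x.1.2 - m)) x.2.1 x.2.2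
    have e : ∀ y z : ℝ, Real.exp (y - z) = Real.exp (-z) * Real.exp y := fun y z => by
      rw [← Real.exp_add]; congr 1; ring
    simp only [e]
    rw [bernMean_const_mul]
    refine (mul_le_mul_of_nonneg_left h (Real.exp_pos _).le).trans (le_of_eq ?_)
    rw [← Real.exp_add, ← Real.exp_add]
    congr 1
    ring
  refine (Finset.sum_le_sum fun x _ => hpt x).trans ?_
  rw [Finset.sum_product]
  -- The two penalties decouple the sum over S and T, giving n^(-4) for each of the (n+2)² ≤ 4n²
  -- pairs of levels.
  have hinner : ∀ y ∈ Finset.range (n + 2) ×ˢ Finset.range (n + 2),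
      ∑ z ∈ E ×ˢ E, Real.exp (-entropyPenalty n y.1 z.1.card) *
        Real.exp (-entropyPenalty n y.2 z.2.card) ≤ 1 / (n : ℝ) ^ 2 * (1 / (n : ℝ) ^ 2) := by
    intro y _
    rw [← Finset.sum_mul_sum E E (fun S => Real.exp (-entropyPenalty n y.1 S.card))
      (fun T => Real.exp (-entropyPenalty n y.2 T.card)) |>.trans (Finset.sum_product' ..).symm]
    exact mul_le_mul (sum_exp_neg_entropyPenalty_le (by omega) _)
      (sum_exp_neg_entropyPenalty_le (by omega) _)
      (Finset.sum_nonneg fun _ _ => (Real.exp_pos _).le) (by positivity)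
  refine (Finset.sum_le_sum hinner).trans ?_
  rw [Finset.sum_const, Finset.card_product, Finset.card_range, nsmul_eq_mul]
  push_cast
  calc ((n : ℝ) + 2) * (n + 2) * (1 / (n : ℝ) ^ 2 * (1 / (n : ℝ) ^ 2)) ≤
        (2 * n) * (2 * n) * (1 / (n : ℝ) ^ 2 * (1 / (n : ℝ) ^ 2)) := by gcongr <;> linarith
    _ = 4 / (n : ℝ) ^ 2 := by field_simp; norm_num

/-- The degree of a node. -/
def nodeDegree (ω : NodePair n → Bool) (i : Fin n) : ℝ := ∑ l, adjacency ω i l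

/-- The upper tail of the degree of a node. -/
lemma prob_degree_le {θ : Matrix (Fin n) (Fin n) ℝ} {β : ℝ} (hθ : θ ∈ sparseSpace n β)
    (i : Fin n) :
    bernProb (edgeProb θ) (fun ω => 5 * (β * n) < nodeDegree ω i) ≤
      Real.exp (-(3 * (β * n))) := by
  refine (bernProb_le_sum_exp (fun p => hθ.2.1 _ _) {()}
    (fun _ ω => nodeDegree ω i - 5 * (β * n)) ?_).trans ?_
  · exact fun ω h => ⟨(), by simp, sub_nonneg.2 h.le⟩
  rw [Finset.sum_singleton]
  set w : Fin n → Fin n → ℝ := fun a _ => if a = i then 1 else 0 with hw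
  have e1 : ∀ ω, Real.exp (nodeDegree ω i - 5 * (β * n)) = Real.exp (-(5 * (β * n))) *
      Real.exp (∑ a, ∑ b, adjacency ω a b * w a b) := fun ω => by
    rw [← Real.exp_add]
    congr 1
    simp only [hw, mul_ite, mul_one, mul_zero, Finset.sum_ite_irrel, Finset.sum_const_zero,
      Finset.sum_ite_eq', Finset.mem_univ, if_true, nodeDegree]
    ring
  simp only [e1]
  rw [bernMean_const_mul]
  refine (mul_le_mul_of_nonneg_left (bernMean_exp_adjacency_le hθ.2.1 w)
    (Real.exp_pos _).le).trans ?_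
  rw [← Real.exp_add]
  refine Real.exp_le_exp.2 ?_
  -- Chernoff with unit tilt: e - 1 ≤ 2 and a mean degree at most βn give 2βn - 5βn = -3βn.
  have hpt : ∀ p : NodePair n, θ p.1.1 p.1.2 *
      (Real.exp (w p.1.1 p.1.2 + w p.1.2 p.1.1) - 1) ≤
      2 * (θ p.1.1 p.1.2 * w p.1.1 p.1.2 + θ p.1.2 p.1.1 * w p.1.2 p.1.1) := fun p => by
    rw [← hθ.1.apply p.1.1 p.1.2]
    have h0 := (hθ.2.1 p.1.2 p.1.1).1
    have he : Real.exp (w p.1.1 p.1.2 + w p.1.2 p.1.1) - 1 ≤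
        2 * (w p.1.1 p.1.2 + w p.1.2 p.1.1) := by
      have hne := p.2.ne
      have h3 := Real.exp_one_lt_d9
      simp only [hw]
      by_cases h1 : p.1.1 = i
      · have h2 : p.1.2 ≠ i := fun h => hne (h.trans h1.symm)
        rw [if_pos h1, if_neg h2, add_zero]
        linarith
      · by_cases h2 : p.1.2 = i
        · rw [if_neg h1, if_pos h2, zero_add]
          linarith
        · rw [if_neg h1, if_neg h2]
          simp
    calc _ ≤ θ p.1.2 p.1.1 * (2 * (w p.1.1 p.1.2 + w p.1.2 p.1.1)) :=
          mul_le_mul_of_nonneg_left he h0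
      _ = _ := by ring
  have hsum : ∑ p : NodePair n, θ p.1.1 p.1.2 *
      (Real.exp (w p.1.1 p.1.2 + w p.1.2 p.1.1) - 1) ≤ 2 * (β * n) := by
    refine (Finset.sum_le_sum fun p _ => hpt p).trans ?_
    rw [← Finset.mul_sum, ← sum_sum_eq_sum_pairs (fun a b => θ a b * w a b)
      (fun a => by rw [hθ.2.2.1, zero_mul])]
    have : ∑ a, ∑ b, θ a b * w a b = ∑ b, θ i b := by
      simp only [hw, mul_ite, mul_one, mul_zero, Finset.sum_ite_irrel, Finset.sum_const_zero,
        Finset.sum_ite_eq', Finset.mem_univ, if_true]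
    rw [this]
    refine mul_le_mul_of_nonneg_left ?_ zero_le_two
    calc ∑ b, θ i b ≤ ∑ _b : Fin n, β := Finset.sum_le_sum fun b _ => hθ.2.2.2 i b
      _ = β * n := by simp [mul_comm]
  linarith

end Concentration

/-! ### Risk of the trimmed and untrimmed adjacency matrices. -/

section UpperBound

variable {n : ℕ}

/-- The noise restricted to the nodes of degree at most `t`. -/
noncomputable def trimmedNoise (θ : Matrix (Fin n) (Fin n) ℝ) (t : ℝ) (ω : NodePair n → Bool) :
    Matrix (Fin n) (Fin n) ℝ :=
  Matrix.of fun i j =>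
    if t < nodeDegree ω i ∨ t < nodeDegree ω j then 0 else adjacency ω i j - θ i j

/-- The part of `-θ` that is lost by removing the nodes of degree larger than `t`. -/
noncomputable def trimmingBias (θ : Matrix (Fin n) (Fin n) ℝ) (t : ℝ) (ω : NodePair n → Bool) :
    Matrix (Fin n) (Fin n) ℝ :=
  Matrix.of fun i j => if t < nodeDegree ω i ∨ t < nodeDegree ω j then -θ i j else 0

lemma trimmedEstimator_sub (θ : Matrix (Fin n) (Fin n) ℝ) (t : ℝ) (ω : NodePair n → Bool) :
    trimmedEstimator n t (adjacency ω) - θ = trimmedNoise θ t ω + trimmingBias θ t ω := by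
  ext i j
  rw [Matrix.sub_apply, Matrix.add_apply, trimmedEstimator, trimmedNoise, trimmingBias,
    Matrix.of_apply, Matrix.of_apply, Matrix.of_apply]
  by_cases h : t < nodeDegree ω i ∨ t < nodeDegree ω j
  · have h' : t < ∑ l, adjacency ω i l ∨ t < ∑ l, adjacency ω j l := h
    rw [if_pos h', if_pos h, if_pos h]
    ring
  · have h' : ¬ (t < ∑ l, adjacency ω i l ∨ t < ∑ l, adjacency ω j l) := h
    rw [if_neg h', if_neg h, if_neg h]
    ring

lemma edgeCount_comm (ω : NodePair n → Bool) (S T : Finset (Fin n)) :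
    edgeCount ω S T = edgeCount ω T S := by
  refine (Finset.sum_comm).trans ?_
  exact Finset.sum_congr rfl fun j _ => Finset.sum_congr rfl fun i _ => adjacency_symm ω i j

lemma edgeCount_le_of_degree_le (ω : NodePair n → Bool) {S : Finset (Fin n)} (T : Finset (Fin n))
    {D : ℝ} (hS : ∀ i ∈ S, nodeDegree ω i ≤ D) : edgeCount ω S T ≤ D * S.card := by
  rw [mul_comm, ← nsmul_eq_mul, ← Finset.sum_const]
  refine Finset.sum_le_sum fun i hi => le_trans ?_ (hS i hi)
  exact Finset.sum_le_sum_of_subset_of_nonneg (Finset.subset_univ T)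
    fun j _ _ => (adjacency_mem ω i j).1

/-- The discrepancy property in the form in which it enters the sum over the levels. -/
lemma Discrepancy.edgeCount_le {β : ℝ} {m s t : ℕ} {ω : NodePair n → Bool} (hβ : 0 ≤ β)
    (h : Discrepancy β m s t ω) (S T : Finset (Fin n)) :
    (1 + (s + t - m : ℕ)) * edgeCount ω S T ≤
      3 * 2 ^ (1 + (s + t - m)) * β * (S.card * T.card) +
        24 * (s * S.card + n / 16 ^ s) + 24 * (t * T.card + n / 16 ^ t) := by
  have hrhs : 0 ≤ 3 * 2 ^ (1 + (s + t - m)) * β * ((S.card : ℝ) * T.card) +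
        24 * (s * S.card + n / 16 ^ s) + 24 * (t * T.card + n / 16 ^ t) := by positivity
  rcases S.eq_empty_or_nonempty with rfl | hS
  · simpa [edgeCount] using hrhs
  rcases T.eq_empty_or_nonempty with rfl | hT
  · simpa [edgeCount] using hrhs
  have h1 := h S T hS hT
  -- Dividing by (log 2)/2 multiplies by at most 3, which is the 3 of the main term. In the entropy,
  -- 3 · 4 log 2 becomes exactly 24.
  have hlog : 2 / 3 ≤ Real.log 2 := by linarith [Real.log_two_gt_d9]
  have hlog0 : 0 < Real.log 2 := by linarith
  have h16 : Real.log 16 = 4 * Real.log 2 := by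
    rw [show (16 : ℝ) = 2 ^ 4 by norm_num, Real.log_pow]; norm_num
  rw [entropyPenalty, entropyPenalty, h16] at h1
  push_cast at h1
  set X := (2 : ℝ) ^ (1 + (s + t - m)) * β * (S.card * T.card) with hX
  have hX0 : 0 ≤ X := by positivity
  set l := Real.log 2 with hl
  set y : ℝ := n / 16 ^ s with hy
  set z : ℝ := n / 16 ^ t with hz
  have hy0 : 0 ≤ y := by positivity
  have hz0 : 0 ≤ z := by positivity
  refine le_of_mul_le_mul_left ?_ (half_pos hlog0)
  calc l / 2 * ((1 + (s + t - m : ℕ)) * edgeCount ω S T)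
      = (1 + (s + t - m : ℕ)) / 2 * l * edgeCount ω S T := by ring
    _ ≤ X + 3 * (S.card * (s * (4 * l)) + y) + 3 * (T.card * (t * (4 * l)) + z) := h1
    _ ≤ l / 2 * (3 * X + 24 * (s * S.card + y) + 24 * (t * T.card + z)) := by
        nlinarith [mul_le_mul_of_nonneg_right hlog hX0, mul_le_mul_of_nonneg_right hlog hy0,
          mul_le_mul_of_nonneg_right hlog hz0]
    _ = _ := by rw [hX]; ring

/-- The heavy part of the bilinear form of `θ`. -/
lemma sum_heavy_mean_le {θ : Matrix (Fin n) (Fin n) ℝ} {β : ℝ} {m : ℕ}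
    (hθ : θ ∈ sparseSpace n β) (hβ : 0 ≤ β) (hm : β * n ≤ 4 * 4 ^ m) {c f : Fin n → ℤ}
    (hc : ∑ i, c i ^ 2 ≤ 9 * (n : ℤ)) (hf : ∑ i, f i ^ 2 ≤ 9 * (n : ℤ)) :
    ∑ i, ∑ j, θ i j * (if m ≤ level c i + level f j then |(c i * f j : ℝ)| else 0) ≤
      324 * n * 2 ^ m := by
  have hpt : ∀ i j, θ i j * (if m ≤ level c i + level f j then |(c i * f j : ℝ)| else 0) ≤
      β / 2 ^ m * (c i * f j : ℝ) ^ 2 := fun i j => by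
    -- A nonzero heavy product has size at least 2^m, so it is bounded by its square over 2^m, and
    -- the Euclidean bounds on c and f apply.
    have hle : (if m ≤ level c i + level f j then |(c i * f j : ℝ)| else 0) ≤
        (c i * f j : ℝ) ^ 2 / 2 ^ m := by
      split_ifs with h
      · rw [le_div_iff₀ (by positivity), ← sq_abs, sq]
        by_cases hc0 : c i = 0
        · simp [hc0]
        by_cases hf0 : f j = 0
        · simp [hf0]
        refine mul_le_mul_of_nonneg_left ?_ (abs_nonneg _)
        rw [abs_mul]
        calc (2 : ℝ) ^ m ≤ 2 ^ (level c i + level f j) := pow_le_pow_right₀ (by norm_num) h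
          _ = 2 ^ level c i * 2 ^ level f j := pow_add _ _ _
          _ ≤ _ := mul_le_mul (two_pow_level_le hc0) (two_pow_level_le hf0) (by positivity)
              (abs_nonneg _)
      · positivity
    have h0 : 0 ≤ (if m ≤ level c i + level f j then |(c i * f j : ℝ)| else 0) := by
      split_ifs <;> positivity
    calc _ ≤ β * (if m ≤ level c i + level f j then |(c i * f j : ℝ)| else 0) :=
          mul_le_mul_of_nonneg_right (hθ.2.2.2 i j) h0
      _ ≤ β * ((c i * f j : ℝ) ^ 2 / 2 ^ m) := mul_le_mul_of_nonneg_left hle hβ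
      _ = _ := by ring
  calc _ ≤ ∑ i, ∑ j, β / 2 ^ m * (c i * f j : ℝ) ^ 2 :=
        Finset.sum_le_sum fun i _ => Finset.sum_le_sum fun j _ => hpt i j
    _ = β / 2 ^ m * ∑ i, ∑ j, (c i * f j : ℝ) ^ 2 := by simp only [Finset.mul_sum]
    _ ≤ β / 2 ^ m * (81 * n ^ 2) :=
        mul_le_mul_of_nonneg_left (sum_mul_sq_le hc hf) (by positivity)
    _ = 81 * n * (β * n) / 2 ^ m := by ring
    _ ≤ 81 * n * (4 * 4 ^ m) / 2 ^ m := by gcongr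
    _ = 324 * n * 2 ^ m := by
        rw [show (4 : ℝ) ^ m = 2 ^ m * 2 ^ m by rw [← mul_pow]; norm_num]
        field_simp
        ring

/-- The heavy part of the bilinear form of the adjacency matrix, for vectors supported on the
nodes of bounded degree. -/
lemma sum_heavy_adjacency_le {β : ℝ} {m : ℕ} {ω : NodePair n → Bool} (hβ : 0 ≤ β)
    (hm : β * n ≤ 4 * 4 ^ m)
    (hdisc : ∀ s ∈ Finset.range (n + 2), ∀ t ∈ Finset.range (n + 2), Discrepancy β m s t ω)
    {c f : Fin n → ℤ} (hc : ∑ i, c i ^ 2 ≤ 9 * (n : ℤ)) (hf : ∑ i, f i ^ 2 ≤ 9 * (n : ℤ))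
    (hcd : ∀ i, c i ≠ 0 → nodeDegree ω i ≤ 5 * (β * n))
    (hfd : ∀ i, f i ≠ 0 → nodeDegree ω i ≤ 5 * (β * n)) :
    ∑ i, ∑ j, adjacency ω i j *
      (if m ≤ level c i + level f j then |(c i * f j : ℝ)| else 0) ≤ 17664 * n * 2 ^ m := by
  have hcN : ∀ i, c i ≠ 0 → level c i < n + 2 := fun i => level_lt hc
  have hfN : ∀ i, f i ≠ 0 → level f i < n + 2 := fun i => level_lt hf
  have hn0 : (0 : ℝ) ≤ n := Nat.cast_nonneg n
  refine (sum_heavy_le m hcN hfN (adjacency ω) fun i j => (adjacency_mem ω i j).1).trans ?_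
  have h := sum_heavy_levels_le (n + 2) m (n := n) (Q := 9 * n) (D := 5 * (β * n)) (β := β)
    hn0 (by positivity) hβ (by positivity) (fun s => (levelSet c s).card)
    (fun t => (levelSet f t).card) (fun _ => Nat.cast_nonneg _) (fun _ => Nat.cast_nonneg _)
    (fun s t => edgeCount ω (levelSet c s) (levelSet f t))
    (sum_four_pow_card_levelSet_le hc hcN) (sum_four_pow_card_levelSet_le hf hfN)
    (fun s t => edgeCount_le_of_degree_le ω _ fun i hi => hcd i (Finset.mem_filter.1 hi).2.1)
    (fun s t => by
      rw [edgeCount_comm]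
      exact edgeCount_le_of_degree_le ω _ fun i hi => hfd i (Finset.mem_filter.1 hi).2.1)
    (fun s hs t ht _ => (hdisc s hs t ht).edgeCount_le hβ _ _)
  have h4 : (4 : ℝ) ^ m = 2 ^ m * 2 ^ m := by rw [← mul_pow]; norm_num
  have b1 : 5 * (β * n) * (9 * n) / 2 ^ m ≤ 180 * n * 2 ^ m := by
    rw [div_le_iff₀ (by positivity)]
    nlinarith [mul_le_mul_of_nonneg_right hm hn0]
  have b2 : 6 * β * (9 * (n : ℝ)) ^ 2 / 2 ^ m ≤ 1944 * n * 2 ^ m := by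
    rw [div_le_iff₀ (by positivity)]
    nlinarith [mul_le_mul_of_nonneg_right hm hn0]
  have h' : ∑ s ∈ Finset.range (n + 2), ∑ t ∈ Finset.range (n + 2),
        (if m ≤ s + t then (2 : ℝ) ^ (s + t) * edgeCount ω (levelSet c s) (levelSet f t)
          -- 4416 = 2 · 180 + 1944 + 192 · 11; the factor 4 of `sum_heavy_le` turns it into 17664.
          else 0) ≤ 4416 * n * 2 ^ m := h.trans (by nlinarith)
  simp only [edgeCount] at h'
  linarith

/-- On the good event, the trimmed noise has operator norm of order `2 ^ m`. -/
lemma opNorm_trimmedNoise_le {θ : Matrix (Fin n) (Fin n) ℝ} {β : ℝ} {m : ℕ}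
    {ω : NodePair n → Bool} (hn : 0 < n) (hθ : θ ∈ sparseSpace n β) (hβ : 0 ≤ β)
    (hm : β * n ≤ 4 * 4 ^ m)
    (hlight : ∀ c ∈ gridBall n, ∀ f ∈ gridBall n,
      ∑ i, ∑ j, (adjacency ω i j - θ i j) * lightPart m c f i j ≤ 256 * n * 2 ^ m)
    (hdisc : ∀ s ∈ Finset.range (n + 2), ∀ t ∈ Finset.range (n + 2), Discrepancy β m s t ω) :
    opNorm (trimmedNoise θ (5 * (β * n)) ω) ≤ 10426 * 2 ^ m := by
  -- 4 · 4561 = 256 + 17664 + 324, the light, heavy adjacency and heavy mean contributions.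
  refine (opNorm_le_of_grid hn _ (4561 * 2 ^ m) fun c₀ f₀ hc₀ hf₀ => ?_).trans ?_
  swap
  · have : (0 : ℝ) < 2 ^ m := by positivity
    linarith
  -- The random trimming is moved from the matrix to the vectors. Zeroing coordinates keeps a vector
  -- in the grid ball, so the estimates uniform over the deterministic grid apply to the trimmed
  -- noise.
  set r : (Fin n → ℤ) → Fin n → ℤ :=
    fun c i => if 5 * (β * n) < nodeDegree ω i then 0 else c i with hr
  have hrd : ∀ c i, r c i ≠ 0 → nodeDegree ω i ≤ 5 * (β * n) := fun c i h => by
    by_contra hlt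
    exact h (by simp only [hr]; rw [if_pos (not_le.1 hlt)])
  have hrsq : ∀ c : Fin n → ℤ, ∑ i, c i ^ 2 ≤ 9 * (n : ℤ) → ∑ i, r c i ^ 2 ≤ 9 * (n : ℤ) :=
    fun c hc => le_trans (Finset.sum_le_sum fun i _ => by
      simp only [hr]
      split_ifs
      · rw [zero_pow two_ne_zero]; exact sq_nonneg _
      · exact le_rfl) hc
  set c := r c₀ with hc
  set f := r f₀ with hf
  have h1 := hlight c (mem_gridBall.2 (hrsq _ hc₀)) f (mem_gridBall.2 (hrsq _ hf₀))
  have h2 := sum_heavy_adjacency_le hβ hm hdisc (hrsq _ hc₀) (hrsq _ hf₀) (hrd c₀) (hrd f₀)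
  have h3 := sum_heavy_mean_le hθ hβ hm (hrsq _ hc₀) (hrsq _ hf₀)
  have hpt : ∀ i j, trimmedNoise θ (5 * (β * n)) ω i j * (c₀ i * f₀ j) ≤
      (adjacency ω i j - θ i j) * lightPart m c f i j +
      adjacency ω i j * (if m ≤ level c i + level f j then |(c i * f j : ℝ)| else 0) +
      θ i j * (if m ≤ level c i + level f j then |(c i * f j : ℝ)| else 0) := fun i j => by
    have e : trimmedNoise θ (5 * (β * n)) ω i j * (c₀ i * f₀ j) =
        (adjacency ω i j - θ i j) * (c i * f j) := by
      simp only [trimmedNoise, Matrix.of_apply, hc, hf, hr]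
      by_cases hi : 5 * (β * n) < nodeDegree ω i <;>
        by_cases hj : 5 * (β * n) < nodeDegree ω j <;> simp [hi, hj]
    rw [e, lightPart]
    by_cases h : m ≤ level c i + level f j
    · rw [if_neg h.not_gt, if_pos h]
      have ha := (adjacency_mem ω i j).1
      have ht := (hθ.2.1 i j).1
      nlinarith [mul_le_mul_of_nonneg_left (le_abs_self (c i * f j : ℝ)) ha,
        mul_le_mul_of_nonneg_left (neg_abs_le (c i * f j : ℝ)) ht]
    · rw [if_pos (not_le.1 h), if_neg h]
      simp
  refine (Finset.sum_le_sum fun i _ => Finset.sum_le_sum fun j _ => hpt i j).trans ?_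
  simp only [Finset.sum_add_distrib]
  nlinarith

/-- The fallback on exceptional events, whose probability of order n^(-2) offsets it. -/
lemma opNorm_sq_le_of_abs_le_one {M : Matrix (Fin n) (Fin n) ℝ} (hM : ∀ i j, |M i j| ≤ 1) :
    opNorm M ^ 2 ≤ (n : ℝ) ^ 2 := by
  refine (opNorm_sq_le_frobenius M).trans ?_
  calc ∑ i, ∑ j, M i j ^ 2 ≤ ∑ _i : Fin n, ∑ _j : Fin n, (1 : ℝ) :=
        Finset.sum_le_sum fun i _ => Finset.sum_le_sum fun j _ =>
          (sq_le_one_iff_abs_le_one _).2 (hM i j)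
    _ = (n : ℝ) ^ 2 := by simp [sq]

lemma abs_adjacency_sub_le {θ : Matrix (Fin n) (Fin n) ℝ} (hθ : ∀ i j, θ i j ∈ Set.Icc (0 : ℝ) 1)
    (ω : NodePair n → Bool) (i j : Fin n) : |adjacency ω i j - θ i j| ≤ 1 := by
  have h1 := adjacency_mem ω i j
  have h2 := hθ i j
  rw [abs_le]
  constructor <;> linarith [h1.1, h1.2, h2.1, h2.2]

/-- The expected squared norm of the trimming bias. -/
lemma bernMean_trimmingBias_le {θ : Matrix (Fin n) (Fin n) ℝ} {β : ℝ}
    (hθ : θ ∈ sparseSpace n β) (hβ : 0 ≤ β) :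
    bernMean (edgeProb θ) (fun ω => opNorm (trimmingBias θ (5 * (β * n)) ω) ^ 2) ≤
      2 * (β * n) := by
  classical
  have hq : ∀ p, edgeProb θ p ∈ Set.Icc (0 : ℝ) 1 := fun p => hθ.2.1 _ _
  set b : Fin n → (NodePair n → Bool) → ℝ :=
    fun i ω => if 5 * (β * n) < nodeDegree ω i then 1 else 0 with hb
  have hpt : ∀ ω, opNorm (trimmingBias θ (5 * (β * n)) ω) ^ 2 ≤
      2 * n * β ^ 2 * ∑ i, b i ω := fun ω => by
    refine (opNorm_sq_le_frobenius _).trans ?_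
    calc _ ≤ ∑ i, ∑ j, β ^ 2 * (b i ω + b j ω) := by
          refine Finset.sum_le_sum fun i _ => Finset.sum_le_sum fun j _ => ?_
          have h1 : θ i j ^ 2 ≤ β ^ 2 := pow_le_pow_left₀ (hθ.2.1 i j).1 (hθ.2.2.2 i j) 2
          have h2 := sq_nonneg β
          simp only [trimmingBias, Matrix.of_apply, hb]
          by_cases hi : 5 * (β * n) < nodeDegree ω i <;>
            by_cases hj : 5 * (β * n) < nodeDegree ω j <;> simp [hi, hj] <;> linarith
      _ = _ := by
          simp only [← Finset.mul_sum, Finset.sum_add_distrib, Finset.sum_const,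
            Finset.card_univ, Fintype.card_fin, nsmul_eq_mul]
          ring
  refine (bernMean_mono hq hpt).trans ?_
  rw [bernMean_const_mul, bernMean_sum]
  have hprob : ∀ i ∈ Finset.univ, bernMean (edgeProb θ) (b i) ≤ Real.exp (-(3 * (β * n))) :=
    fun i _ => le_trans (le_of_eq (by rw [bernProb])) (prob_degree_le hθ i)
  refine (mul_le_mul_of_nonneg_left (Finset.sum_le_sum hprob) (by positivity)).trans ?_
  rw [Finset.sum_const, Finset.card_univ, Fintype.card_fin, nsmul_eq_mul]
  set d := β * n with hd
  have hd0 : 0 ≤ d := by positivity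
  -- The Frobenius bound leaves 2d² exp(-3d); the degree tail pays for one factor d.
  have h1 : d * Real.exp (-(3 * d)) ≤ 1 := by
    rw [Real.exp_neg, ← div_eq_mul_inv, div_le_one (Real.exp_pos _)]
    linarith [Real.add_one_le_exp (3 * d)]
  calc 2 * n * β ^ 2 * (n * Real.exp (-(3 * d))) = 2 * d * (d * Real.exp (-(3 * d))) := by
        rw [hd]; ring
    _ ≤ 2 * d * 1 := mul_le_mul_of_nonneg_left h1 (by positivity)
    _ = 2 * d := mul_one _

/-- The risk of the trimmed adjacency matrix. -/
lemma bernMean_trimmed_le {θ : Matrix (Fin n) (Fin n) ℝ} {β : ℝ} (hn : 2 ≤ n)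
    (hθ : θ ∈ sparseSpace n β) (hβ : (n : ℝ)⁻¹ ≤ β) :
    bernMean (edgeProb θ)
      (fun ω => opNorm (trimmedEstimator n (5 * (β * n)) (adjacency ω) - θ) ^ 2) ≤
      217403000 * (β * n) := by
  have hn' : (0 : ℝ) < n := by exact_mod_cast (by omega : 0 < n)
  have hβ0 : 0 ≤ β := (inv_pos.2 hn').le.trans hβ
  have hq : ∀ p, edgeProb θ p ∈ Set.Icc (0 : ℝ) 1 := fun p => hθ.2.1 _ _
  have hd1 : 1 ≤ β * n := by
    have := mul_le_mul_of_nonneg_right hβ hn'.le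
    rwa [inv_mul_cancel₀ hn'.ne'] at this
  -- 4^m ≤ βn < 4^(m+1) makes 2^m comparable to √(βn), balancing light and heavy parts; `hm1` turns
  -- 4^m back into βn at the end.
  obtain ⟨m, hm1, hm2⟩ := exists_nat_pow_near hd1 (by norm_num : (1 : ℝ) < 4)
  have hm : β * n ≤ 4 * 4 ^ m := by rw [pow_succ] at hm2; linarith
  set t := 5 * (β * n) with ht
  set Light : (NodePair n → Bool) → Prop := fun ω => ∃ c ∈ gridBall n, ∃ f ∈ gridBall n,
      256 * n * 2 ^ m < ∑ i, ∑ j, (adjacency ω i j - θ i j) * lightPart m c f i j with hL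
  set Disc : (NodePair n → Bool) → Prop := fun ω => ∃ s ∈ Finset.range (n + 2),
      ∃ t ∈ Finset.range (n + 2), ¬ Discrepancy β m s t ω with hD
  have hsq : ∀ ω, opNorm (trimmedEstimator n t (adjacency ω) - θ) ^ 2 ≤
      2 * opNorm (trimmedNoise θ t ω) ^ 2 + 2 * opNorm (trimmingBias θ t ω) ^ 2 := fun ω => by
    rw [trimmedEstimator_sub]
    have h1 := pow_le_pow_left₀ (opNorm_nonneg _)
      (opNorm_add_le (trimmedNoise θ t ω) (trimmingBias θ t ω)) 2
    nlinarith [sq_nonneg (opNorm (trimmedNoise θ t ω) - opNorm (trimmingBias θ t ω))]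
  have hgood : ∀ ω, ¬ (Light ω ∨ Disc ω) →
      opNorm (trimmedEstimator n t (adjacency ω) - θ) ^ 2 ≤
        2 * (10426 ^ 2 * (β * n)) + 2 * opNorm (trimmingBias θ t ω) ^ 2 := fun ω hω => by
    push Not at hω
    have h1 := opNorm_trimmedNoise_le (by omega : 0 < n) hθ hβ0 hm
      (fun c hc f hf => not_lt.1 fun h => hω.1 ⟨c, hc, f, hf, h⟩)
      (fun s hs t ht => by_contra fun h => hω.2 ⟨s, hs, t, ht, h⟩)
    have h2 := pow_le_pow_left₀ (opNorm_nonneg _) h1 2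
    rw [mul_pow, ← pow_mul, mul_comm m, pow_mul, show (2 : ℝ) ^ 2 = 4 by norm_num] at h2
    have h3 := hsq ω
    linarith
  have hall : ∀ ω, opNorm (trimmedEstimator n t (adjacency ω) - θ) ^ 2 ≤
        2 * (10426 ^ 2 * (β * n)) + 2 * opNorm (trimmingBias θ t ω) ^ 2 + 2 * n ^ 2 := fun ω => by
    have h1 : opNorm (trimmedNoise θ t ω) ^ 2 ≤ (n : ℝ) ^ 2 :=
      opNorm_sq_le_of_abs_le_one fun i j => by
        simp only [trimmedNoise, Matrix.of_apply]
        split_ifs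
        · simp
        · exact abs_adjacency_sub_le hθ.2.1 ω i j
    have h3 := hsq ω
    have h4 : 0 ≤ 2 * (10426 ^ 2 * (β * n)) := by positivity
    linarith
  have hprob : bernProb (edgeProb θ) (fun ω => Light ω ∨ Disc ω) ≤ 6 / (n : ℝ) ^ 2 := by
    refine (bernProb_or_le hq _ _).trans ?_
    have h1 := prob_light_le hθ hβ0 hm
    have h2 := prob_discrepancy_le m hn hθ hβ0
    have h3 : Real.exp (-n) ≤ 2 / (n : ℝ) ^ 2 := by
      rw [Real.exp_neg, ← one_div, div_le_div_iff₀ (Real.exp_pos _) (by positivity)]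
      linarith [Real.quadratic_le_exp_of_nonneg hn'.le]
    calc _ ≤ 2 / (n : ℝ) ^ 2 + 4 / (n : ℝ) ^ 2 := add_le_add (h1.trans h3) h2
      _ = _ := by ring
  refine (bernMean_le_add_mul_prob hq _ hgood hall).trans ?_
  rw [bernMean_add, bernMean_const, bernMean_const_mul]
  have h1 := bernMean_trimmingBias_le hθ hβ0
  have h2 : 2 * (n : ℝ) ^ 2 * bernProb (edgeProb θ) (fun ω => Light ω ∨ Disc ω) ≤ 12 := by
    calc _ ≤ 2 * (n : ℝ) ^ 2 * (6 / (n : ℝ) ^ 2) := mul_le_mul_of_nonneg_left hprob (by positivity)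
      _ = 12 := by field_simp; norm_num
  linarith

/-- The risk of the adjacency matrix in the regime of logarithmic average degrees. -/
lemma bernMean_adjacency_le {θ : Matrix (Fin n) (Fin n) ℝ} {β : ℝ} (hn : 2 ≤ n)
    (hθ : θ ∈ sparseSpace n β) (hβ : (n : ℝ)⁻¹ ≤ β) (hlog : Real.log n / n ≤ β) :
    bernMean (edgeProb θ) (fun ω => opNorm (adjacency ω - θ) ^ 2) ≤
      300000000 * (β * n) := by
  have hn' : (0 : ℝ) < n := by exact_mod_cast (by omega : 0 < n)
  have hq : ∀ p, edgeProb θ p ∈ Set.Icc (0 : ℝ) 1 := fun p => hθ.2.1 _ _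
  have hd1 : 1 ≤ β * n := by
    have := mul_le_mul_of_nonneg_right hβ hn'.le
    rwa [inv_mul_cancel₀ hn'.ne'] at this
  have hdlog : Real.log n ≤ β * n := (div_le_iff₀ hn').1 hlog
  have hprob : bernProb (edgeProb θ)
      (fun ω => ∃ i ∈ Finset.univ, 5 * (β * n) < nodeDegree ω i) ≤ 1 / (n : ℝ) ^ 2 := by
    refine (bernProb_exists_le hq _ _).trans ((Finset.sum_le_sum fun i _ =>
      prob_degree_le hθ i).trans ?_)
    rw [Finset.sum_const, Finset.card_univ, Fintype.card_fin, nsmul_eq_mul]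
    -- The logarithmic regime enters only here: the tail n^(-3) survives a union bound over n nodes,
    -- and n^(-2) remains to cancel the fallback n².
    have h1 : Real.exp (-(3 * (β * n))) ≤ 1 / (n : ℝ) ^ 3 := by
      rw [Real.exp_neg, ← one_div]
      refine one_div_le_one_div_of_le (by positivity) ?_
      calc (n : ℝ) ^ 3 = Real.exp (3 * Real.log n) := by
            rw [mul_comm, Real.exp_mul, Real.exp_log hn']; norm_cast
        _ ≤ _ := Real.exp_le_exp.2 (by linarith)
    calc (n : ℝ) * Real.exp (-(3 * (β * n))) ≤ n * (1 / (n : ℝ) ^ 3) :=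
          mul_le_mul_of_nonneg_left h1 hn'.le
      _ = 1 / (n : ℝ) ^ 2 := by field_simp
  refine (bernMean_le_add_mul_prob hq
    (g := fun ω => opNorm (trimmedEstimator n (5 * (β * n)) (adjacency ω) - θ) ^ 2)
    (b := (n : ℝ) ^ 2) _ (fun ω hω => ?_) fun ω => ?_).trans
    (add_le_add (bernMean_trimmed_le hn hθ hβ)
      (mul_le_mul_of_nonneg_left hprob (by positivity))) |>.trans ?_
  · push Not at hω
    refine le_of_eq ?_
    congr 3
    ext i j
    have hi := hω i (Finset.mem_univ i)
    have hj := hω j (Finset.mem_univ j)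
    rw [nodeDegree] at hi hj
    simp only [trimmedEstimator, Matrix.of_apply]
    rw [if_neg (not_or.2 ⟨hi.not_gt, hj.not_gt⟩)]
  · have h1 : opNorm (adjacency ω - θ) ^ 2 ≤ (n : ℝ) ^ 2 :=
      opNorm_sq_le_of_abs_le_one fun i j => abs_adjacency_sub_le hθ.2.1 ω i j
    have h2 := sq_nonneg (opNorm (trimmedEstimator n (5 * (β * n)) (adjacency ω) - θ))
    linarith
  · have : (n : ℝ) ^ 2 * (1 / (n : ℝ) ^ 2) = 1 := by field_simp
    rw [this]
    linarith

lemma worstRisk_trimmed_le {β : ℝ} (hn : 2 ≤ n) (hβ : (n : ℝ)⁻¹ ≤ β) :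
    worstRisk (trimmedEstimator n (5 * (β * n))) (sparseSpace n β) ≤
      ENNReal.ofReal (300000000 * (β * n)) := by
  refine iSup₂_le fun θ hθ => ?_
  rw [risk_eq _ hθ.2.1]
  refine ENNReal.ofReal_le_ofReal ((bernMean_trimmed_le hn hθ hβ).trans ?_)
  have : 0 ≤ β * n := mul_nonneg ((inv_nonneg.2 (Nat.cast_nonneg n)).trans hβ) (Nat.cast_nonneg n)
  linarith

lemma worstRisk_adjacency_le {β : ℝ} (hn : 2 ≤ n) (hβ : (n : ℝ)⁻¹ ≤ β)
    (hlog : Real.log n / n ≤ β) :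
    worstRisk (adjacencyEstimator n) (sparseSpace n β) ≤
      ENNReal.ofReal (300000000 * (β * n)) := by
  refine iSup₂_le fun θ hθ => ?_
  rw [risk_eq _ hθ.2.1]
  exact ENNReal.ofReal_le_ofReal (bernMean_adjacency_le hn hθ hβ hlog)

lemma worstRisk_mono (est : Estimator n) {Θ Θ' : Set (Matrix (Fin n) (Fin n) ℝ)} (h : Θ ⊆ Θ') :
    worstRisk est Θ ≤ worstRisk est Θ' :=
  biSup_mono fun _ hθ => h hθ

lemma minimaxRisk_mono {Θ Θ' : Set (Matrix (Fin n) (Fin n) ℝ)} (h : Θ ⊆ Θ') :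
    minimaxRisk Θ ≤ minimaxRisk Θ' :=
  iInf_mono fun est => worstRisk_mono est h

end UpperBound

end NetworkRisk

/-! ### Assembly of the bounds. -/

theorem theorem3p6 :
    ∃ C τ : ℝ, 0 < C ∧ 0 < τ ∧
      ∀ (n k : ℕ) (β : ℝ), 2 ≤ n → 2 ≤ k → (n : ℝ)⁻¹ ≤ β → β ≤ 1 →
        (ENNReal.ofReal (C⁻¹ * (β * n)) ≤
            NetworkRisk.minimaxRisk (NetworkRisk.sparseSpace n β ∩ NetworkRisk.blockSpace n k) ∧
          NetworkRisk.minimaxRisk (NetworkRisk.sparseSpace n β ∩ NetworkRisk.blockSpace n k) ≤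
            ENNReal.ofReal (C * (β * n))) ∧
        (ENNReal.ofReal (C⁻¹ * (β * n)) ≤
            NetworkRisk.minimaxRisk (NetworkRisk.sparseSpace n β) ∧
          NetworkRisk.minimaxRisk (NetworkRisk.sparseSpace n β) ≤
            ENNReal.ofReal (C * (β * n))) ∧
        (Real.log n / n ≤ β →
          NetworkRisk.worstRisk (NetworkRisk.adjacencyEstimator n)
              (NetworkRisk.sparseSpace n β) ≤
            ENNReal.ofReal (C * (β * n))) ∧
        (β < Real.log n / n →
          NetworkRisk.worstRisk (NetworkRisk.trimmedEstimator n (τ * (β * n)))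
              (NetworkRisk.sparseSpace n β) ≤
            ENNReal.ofReal (C * (β * n))) := by
  refine ⟨300000000, 5, by norm_num, by norm_num, fun n k β hn hk hβ hβ1 => ?_⟩
  have hlow : ENNReal.ofReal ((300000000 : ℝ)⁻¹ * (β * n)) ≤
      NetworkRisk.minimaxRisk (NetworkRisk.sparseSpace n β ∩ NetworkRisk.blockSpace n k) := by
    refine le_trans (ENNReal.ofReal_le_ofReal ?_) (NetworkRisk.le_minimaxRisk hn hk hβ hβ1)
    have : 0 ≤ β * n :=
      mul_nonneg ((inv_nonneg.2 (Nat.cast_nonneg n)).trans hβ) (Nat.cast_nonneg n)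
    norm_num
    linarith
  -- The trimmed matrix attains the rate for every β ≥ 1/n, so no case distinction is needed.
  have hup : NetworkRisk.minimaxRisk (NetworkRisk.sparseSpace n β) ≤
      ENNReal.ofReal (300000000 * (β * n)) :=
    (iInf_le _ _).trans (NetworkRisk.worstRisk_trimmed_le hn hβ)
  have hmono := NetworkRisk.minimaxRisk_mono
    (Set.inter_subset_left (s := NetworkRisk.sparseSpace n β) (t := NetworkRisk.blockSpace n k))
  exact ⟨⟨hlow, hmono.trans hup⟩, ⟨hlow.trans hmono, hup⟩,
    NetworkRisk.worstRisk_adjacency_le hn hβ, fun _ => NetworkRisk.worstRisk_trimmed_le hn hβ⟩
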